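/- Let $G$ be a Lie group, let $M$ be a path-connected smooth manifold, and let $\pi : P \to M$ be a smooth principal $G$-bundle with a smooth connection, given by its connection form $\omega$, a $\mathfrak g$-valued $1$-form on $P$ (all manifolds are finite-dimensional, Hausdorff and without boundary). Assume that the connection is flat, i.e. its curvature $\Omega = d\omega + \tfrac12[\omega\wedge\omega]$ vanishes identically. For $p_0 \in P$ let the holonomy group $\mathrm{Hol}_{p_0}(\omega) \subseteq G$ be the subgroup of all $g \in G$ such that, for some piecewise $C^1$ loop $c$ in $M$ based at $\pi(p_0)$, the horizontal lift of $c$ that starts at $p_0$ ends at $p_0 \cdot g$. The system is called genuinely non-Abelian if $\mathrm{Hol}_{p_0}(\omega)$ is a non-Abelian group for some reference point $p_0 \in P$ (equivalently, for every one). If the system is genuinely non-Abelian, then 1. the gauge group $G$ is non-Abelian, and 2. the fundamental group $\pi_1(M)$ is non-Abelian, i.e. $\pi_1(M, x)$ is non-Abelian for every base point $x \in M$. -/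

import Mathlib

open Set
open scoped Manifold ContDiff Topology

noncomputable section

section Curves

variable {E : Type*} [NormedAddCommGroup E] [NormedSpace ℝ E]
  {H : Type*} [TopologicalSpace H] (I : ModelWithCorners ℝ E H)
  {X : Type*} [TopologicalSpace X] [ChartedSpace H X]

/-- The restriction of `γ` to `[0, 1]` is piecewise `C¹` with break points in the finite set `s`:
it is `C¹` on every closed subinterval `[a, b]` without a break point in its interior
(one-sided derivatives being understood at `a` and at `b`). -/
def IsPiecewiseC1With (γ : ℝ → X) (s : Set ℝ) : Prop :=
  s.Finite ∧ ∀ a b : ℝ, 0 ≤ a → a < b → b ≤ 1 → Disjoint (Ioo a b) s →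
    ContMDiffOn 𝓘(ℝ, ℝ) I 1 γ (Icc a b)

/-- A continuous path that is piecewise `C¹`. -/
def IsPiecewiseC1 {x y : X} (γ : Path x y) : Prop :=
  ∃ s : Set ℝ, IsPiecewiseC1With I (γ.extend : ℝ → X) s

namespace IsPiecewiseC1With

variable {I} {γ δ : ℝ → X} {s s' : Set ℝ}

theorem comp_contMDiff {E' : Type*} [NormedAddCommGroup E'] [NormedSpace ℝ E']
    {H' : Type*} [TopologicalSpace H'] {I' : ModelWithCorners ℝ E' H'}
    {Y : Type*} [TopologicalSpace Y] [ChartedSpace H' Y] {f : X → Y}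
    (hγ : IsPiecewiseC1With I γ s) (hf : ContMDiff I I' 1 f) :
    IsPiecewiseC1With I' (fun t => f (γ t)) s :=
  ⟨hγ.1, fun a b ha hab hb hd => hf.comp_contMDiffOn (hγ.2 a b ha hab hb hd)⟩

/-- Reversal of a piecewise `C¹` curve. -/
theorem reverse (hγ : IsPiecewiseC1With I γ s) :
    IsPiecewiseC1With I (fun t => γ (1 - t)) ((fun t => 1 - t) '' s) := by
  refine ⟨hγ.1.image _, fun a b ha hab hb hd => ?_⟩
  have h := hγ.2 (1 - b) (1 - a) (by linarith) (by linarith) (by linarith) (by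
    rw [Set.disjoint_left] at hd ⊢
    intro t ht hts
    exact hd (a := 1 - t) ⟨by linarith [ht.2], by linarith [ht.1]⟩ ⟨t, hts, rfl⟩)
  have hl : ContMDiff 𝓘(ℝ, ℝ) 𝓘(ℝ, ℝ) 1 (fun t : ℝ => 1 - t) :=
    ContDiff.contMDiff (by fun_prop)
  exact h.comp hl.contMDiffOn fun t ht => ⟨by linarith [ht.2], by linarith [ht.1]⟩

/-- The set of break points used for the concatenation of two curves. -/
def concatBreaks (s s' : Set ℝ) : Set ℝ :=
  insert (1 / 2) ((fun t => t / 2) '' s ∪ (fun t => (t + 1) / 2) '' s')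

/-- Concatenation of piecewise `C¹` curves. -/
theorem concat {η : ℝ → X} (hγ : IsPiecewiseC1With I γ s) (hδ : IsPiecewiseC1With I δ s')
    (h₁ : ∀ t ≤ 1 / 2, η t = γ (2 * t)) (h₂ : ∀ t, 1 / 2 ≤ t → η t = δ (2 * t - 1)) :
    IsPiecewiseC1With I η (concatBreaks s s') := by
  refine ⟨((hγ.1.image _).union (hδ.1.image _)).insert _, fun a b ha hab hb hd => ?_⟩
  rw [Set.disjoint_left] at hd
  rcases le_or_gt b (1 / 2) with hb' | hb'
  · have h := hγ.2 (2 * a) (2 * b) (by linarith) (by linarith) (by linarith) (by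
      rw [Set.disjoint_left]
      intro t ht hts
      exact hd (a := t / 2) ⟨by linarith [ht.1], by linarith [ht.2]⟩
        (Or.inr (Or.inl ⟨t, hts, rfl⟩)))
    have hl : ContMDiff 𝓘(ℝ, ℝ) 𝓘(ℝ, ℝ) 1 (fun t : ℝ => 2 * t) :=
      ContDiff.contMDiff (by fun_prop)
    refine (h.comp hl.contMDiffOn fun t ht => ?_).congr fun t ht => h₁ t (ht.2.trans hb')
    exact ⟨by linarith [ht.1], by linarith [ht.2]⟩
  · have ha' : 1 / 2 ≤ a := by
      by_contra hc
      exact hd (a := 1 / 2) ⟨not_le.1 hc, hb'⟩ (Or.inl rfl)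
    have h := hδ.2 (2 * a - 1) (2 * b - 1) (by linarith) (by linarith) (by linarith) (by
      rw [Set.disjoint_left]
      intro t ht hts
      exact hd (a := (t + 1) / 2) ⟨by linarith [ht.1], by linarith [ht.2]⟩
        (Or.inr (Or.inr ⟨t, hts, rfl⟩)))
    have hl : ContMDiff 𝓘(ℝ, ℝ) 𝓘(ℝ, ℝ) 1 (fun t : ℝ => 2 * t - 1) :=
      ContDiff.contMDiff (by fun_prop)
    refine (h.comp hl.contMDiffOn fun t ht => ?_).congr fun t ht => h₂ t (ha'.trans ht.1)
    exact ⟨by linarith [ht.1], by linarith [ht.2]⟩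

theorem mdifferentiableAt (hγ : IsPiecewiseC1With I γ s) {t : ℝ} (ht : t ∈ Ioo (0 : ℝ) 1)
    (hts : t ∉ s) : MDifferentiableAt 𝓘(ℝ, ℝ) I γ t := by
  have hU : Ioo (0 : ℝ) 1 ∩ sᶜ ∈ 𝓝 t :=
    (isOpen_Ioo.inter hγ.1.isClosed.isOpen_compl).mem_nhds ⟨ht, hts⟩
  obtain ⟨ε, hε, hεU⟩ := Metric.mem_nhds_iff.1 hU
  rw [Real.ball_eq_Ioo] at hεU
  have h := hγ.2 (t - ε / 2) (t + ε / 2)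
    (hεU (show t - ε / 2 ∈ _ from ⟨by linarith, by linarith⟩)).1.1.le (by linarith)
    (hεU (show t + ε / 2 ∈ _ from ⟨by linarith, by linarith⟩)).1.2.le (by
      rw [Set.disjoint_left]
      intro r hr
      exact (hεU (show r ∈ _ from ⟨by linarith [hr.1], by linarith [hr.2]⟩)).2)
  exact (h.contMDiffAt (Icc_mem_nhds (by linarith) (by linarith))).mdifferentiableAt (by simp)

end IsPiecewiseC1With

theorem IsPiecewiseC1.refl (x : X) : IsPiecewiseC1 I (Path.refl x) :=
  ⟨∅, Set.finite_empty, fun a b _ _ _ _ =>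
    (contMDiffOn_const : ContMDiffOn 𝓘(ℝ, ℝ) I 1 (fun _ : ℝ => x) (Icc a b))⟩

variable {I} in
theorem IsPiecewiseC1.symm {x y : X} {γ : Path x y} (hγ : IsPiecewiseC1 I γ) :
    IsPiecewiseC1 I γ.symm := by
  obtain ⟨s, hs⟩ := hγ
  exact ⟨_, by rw [Path.extend_symm]; exact hs.reverse⟩

variable {I} in
theorem IsPiecewiseC1.trans {x y z : X} {γ : Path x y} {δ : Path y z}
    (hγ : IsPiecewiseC1 I γ) (hδ : IsPiecewiseC1 I δ) : IsPiecewiseC1 I (γ.trans δ) := by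
  obtain ⟨s, hs⟩ := hγ
  obtain ⟨s', hs'⟩ := hδ
  exact ⟨_, hs.concat hs' (fun t ht => Path.extend_trans_of_le_half γ δ ht)
    (fun t ht => Path.extend_trans_of_half_le γ δ ht)⟩

end Curves

section Bundles

variable {EM : Type*} [NormedAddCommGroup EM] [NormedSpace ℝ EM]
  {HM : Type*} [TopologicalSpace HM] (IM : ModelWithCorners ℝ EM HM)
  {EG : Type*} [NormedAddCommGroup EG] [NormedSpace ℝ EG]
  {HG : Type*} [TopologicalSpace HG] (IG : ModelWithCorners ℝ EG HG)
  {EP : Type*} [NormedAddCommGroup EP] [NormedSpace ℝ EP]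
  {HP : Type*} [TopologicalSpace HP] (IP : ModelWithCorners ℝ EP HP)
  (M : Type*) [TopologicalSpace M] [ChartedSpace HM M]
  (G : Type*) [TopologicalSpace G] [ChartedSpace HG G] [Group G]
  (P : Type*) [TopologicalSpace P] [ChartedSpace HP P]

/-- A smooth principal `G`-bundle `proj : P → M`: a smooth right action `act p g = p · g` of `G`
on `P` that preserves the fibres, and around every point of `M` a smooth local trivialization
`proj ⁻¹(U) ≃ U × G` that is equivariant for the right action. -/
structure PrincipalBundle where
  /-- the bundle projection -/
  proj : P → M
  /-- the right action of the structure group -/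
  act : P → G → P
  act_one : ∀ p, act p 1 = p
  act_mul : ∀ p g h, act p (g * h) = act (act p g) h
  proj_act : ∀ p g, proj (act p g) = proj p
  contMDiff_proj : ContMDiff IP IM ∞ proj
  contMDiff_act : ContMDiff (IP.prod IG) IP ∞ (fun q : P × G => act q.1 q.2)
  exists_trivialization : ∀ x : M, ∃ e : Bundle.Trivialization G proj,
    x ∈ e.baseSet ∧
    ContMDiffOn IP (IM.prod IG) ∞ e e.source ∧
    ContMDiffOn (IM.prod IG) IP ∞ e.toOpenPartialHomeomorph.symm e.target ∧
    ∀ p ∈ e.source, ∀ g : G, (e (act p g)).2 = (e p).2 * g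

end Bundles

section AdjointRepresentation

variable {EG : Type*} [NormedAddCommGroup EG] [NormedSpace ℝ EG]
  {HG : Type*} [TopologicalSpace HG] (IG : ModelWithCorners ℝ EG HG)
  {G : Type*} [TopologicalSpace G] [ChartedSpace HG G] [Group G]

/-- The adjoint action of `g` on the Lie algebra: the derivative at `1` of `h ↦ g h g⁻¹`. -/
def adjointAction (g : G) (ξ : GroupLieAlgebra IG G) : GroupLieAlgebra IG G :=
  mfderiv IG IG (fun h : G => g * h * g⁻¹) 1 ξ

end AdjointRepresentation

section Forms

variable {EP : Type*} [NormedAddCommGroup EP] [NormedSpace ℝ EP]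
  {HP : Type*} [TopologicalSpace HP] (IP : ModelWithCorners ℝ EP HP)
  {P : Type*} [TopologicalSpace P] [ChartedSpace HP P]
  {F : Type*} [NormedAddCommGroup F] [NormedSpace ℝ F]

/-- The expression of an `F`-valued `1`-form in the chart at `q`, that is, its pullback under the
inverse of the chart. -/
def formInChart (α : (p : P) → TangentSpace IP p →L[ℝ] F) (q : P) : EP → (EP →L[ℝ] F) :=
  fun x => (α ((extChartAt IP q).symm x)).comp
    (mfderiv 𝓘(ℝ, EP) IP (extChartAt IP q).symm x)

/-- An `F`-valued `1`-form is smooth if it is so in every chart. -/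
def IsSmoothForm (α : (p : P) → TangentSpace IP p →L[ℝ] F) : Prop :=
  ∀ q : P, ContDiffOn ℝ ∞ (formInChart IP α q) (extChartAt IP q).target

/-- The value `dα(u, v)` at `p` of the exterior derivative of a `1`-form, computed in the chart
at `q` (where `p` lies in the domain of that chart; the value does not depend on `q`):
`∂ᵤ(α(v)) - ∂ᵥ(α(u))`. -/
def exteriorDerivative (α : (p : P) → TangentSpace IP p →L[ℝ] F) (q p : P)
    (u v : TangentSpace IP p) : F :=
  let u' : EP := mfderiv IP 𝓘(ℝ, EP) (extChartAt IP q) p u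
  let v' : EP := mfderiv IP 𝓘(ℝ, EP) (extChartAt IP q) p v
  fderiv ℝ (formInChart IP α q) (extChartAt IP q p) u' v' -
    fderiv ℝ (formInChart IP α q) (extChartAt IP q p) v' u'

end Forms

section Connections

variable {EM : Type*} [NormedAddCommGroup EM] [NormedSpace ℝ EM]
  {HM : Type*} [TopologicalSpace HM] {IM : ModelWithCorners ℝ EM HM}
  {EG : Type*} [NormedAddCommGroup EG] [NormedSpace ℝ EG]
  {HG : Type*} [TopologicalSpace HG] {IG : ModelWithCorners ℝ EG HG}
  {EP : Type*} [NormedAddCommGroup EP] [NormedSpace ℝ EP]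
  {HP : Type*} [TopologicalSpace HP] {IP : ModelWithCorners ℝ EP HP}
  {M : Type*} [TopologicalSpace M] [ChartedSpace HM M]
  {G : Type*} [TopologicalSpace G] [ChartedSpace HG G] [Group G]
  {P : Type*} [TopologicalSpace P] [ChartedSpace HP P]

theorem PrincipalBundle.contMDiff_act_right (B : PrincipalBundle IM IG IP M G P) (g : G) :
    ContMDiff IP IP ∞ (fun p => B.act p g) :=
  B.contMDiff_act.comp (contMDiff_id.prodMk contMDiff_const)

/-- The fundamental vector field of `ξ` at `p`: the derivative at `1` of `g ↦ p · g`, applied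
to `ξ`. -/
def PrincipalBundle.fundamental (B : PrincipalBundle IM IG IP M G P) (p : P)
    (ξ : GroupLieAlgebra IG G) : TangentSpace IP p :=
  mfderiv IG IP (B.act p) 1 ξ

/-- A connection (gauge potential) on a principal bundle, given by its connection form: a smooth
Lie algebra valued `1`-form on the total space that reproduces the generators of the fundamental
vector fields and is equivariant for the right action. -/
structure PrincipalConnection (B : PrincipalBundle IM IG IP M G P) where
  /-- the connection form -/
  form : (p : P) → TangentSpace IP p →L[ℝ] GroupLieAlgebra IG G
  smooth : IsSmoothForm (F := EG) IP form
  form_fundamental : ∀ (p : P) (ξ : GroupLieAlgebra IG G), form p (B.fundamental p ξ) = ξ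
  form_act : ∀ (p : P) (g : G) (u : TangentSpace IP p),
    form (B.act p g) (mfderiv IP IP (fun r => B.act r g) p u) =
      adjointAction IG g⁻¹ (form p u)

namespace PrincipalConnection

variable {B : PrincipalBundle IM IG IP M G P} (A : PrincipalConnection B)

/-- The curvature form `Ω(u, v) = dω(u, v) + [ω(u), ω(v)]` at `p`, where `dω` is computed in the
chart at `q`. -/
def curvature (q p : P) (u v : TangentSpace IP p) : GroupLieAlgebra IG G :=
  let dω : GroupLieAlgebra IG G := exteriorDerivative (F := EG) IP A.form q p u v
  dω + ⁅A.form p u, A.form p v⁆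

/-- The connection is flat: its curvature vanishes identically. -/
def IsFlat : Prop :=
  ∀ q p : P, p ∈ (extChartAt IP q).source → ∀ u v : TangentSpace IP p, A.curvature q p u v = 0

/-- The velocity of `γ` at `t` is horizontal. -/
def IsHorizontalAt (γ : ℝ → P) (t : ℝ) : Prop :=
  A.form (γ t) (mfderiv 𝓘(ℝ, ℝ) IP γ t (1 : ℝ)) = 0

/-- A path in the total space is horizontal if it is piecewise `C¹` and the connection form
vanishes on its velocity (away from the break points). -/
def IsHorizontal {p q : P} (γ : Path p q) : Prop :=
  ∃ s : Set ℝ, IsPiecewiseC1With IP (γ.extend : ℝ → P) s ∧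
    ∀ t ∈ Ioo (0 : ℝ) 1, t ∉ s → A.IsHorizontalAt (γ.extend : ℝ → P) t

/-- `g` is the holonomy of the loop `c` with respect to the reference point `p₀`: the horizontal
lift of `c` that starts at `p₀` ends at `p₀ · g`. -/
def IsHolonomy (p₀ : P) (c : Path (B.proj p₀) (B.proj p₀)) (g : G) : Prop :=
  ∃ γ : Path p₀ (B.act p₀ g), A.IsHorizontal γ ∧ ∀ t, B.proj (γ t) = c t

section HolonomyGroup

variable {A}

theorem IsHorizontalAt.congr {γ δ : ℝ → P} {t : ℝ} (h : A.IsHorizontalAt γ t)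
    (hδ : δ =ᶠ[𝓝 t] γ) : A.IsHorizontalAt δ t := by
  unfold IsHorizontalAt at h ⊢
  rw [hδ.mfderiv_eq, hδ.eq_of_nhds]
  exact h

theorem IsHorizontalAt.comp_affine {γ : ℝ → P} {t : ℝ} (a b : ℝ)
    (hγ : MDifferentiableAt 𝓘(ℝ, ℝ) IP γ (a * t + b))
    (h : A.IsHorizontalAt γ (a * t + b)) : A.IsHorizontalAt (fun r => γ (a * r + b)) t := by
  have hl : HasDerivAt (fun r : ℝ => a * r + b) a t := by
    simpa using ((hasDerivAt_id t).const_mul a).add_const b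
  have hc := hγ.hasMFDerivAt.comp t hl.hasFDerivAt.hasMFDerivAt
  unfold IsHorizontalAt at h ⊢
  change A.form (γ (a * t + b)) (mfderiv 𝓘(ℝ, ℝ) IP (γ ∘ fun r : ℝ => a * r + b) t (1 : ℝ)) = 0
  rw [hc.mfderiv]
  let L : ℝ →L[ℝ] EG :=
    (A.form (γ (a * t + b))).comp (mfderiv 𝓘(ℝ, ℝ) IP γ (a * t + b))
  have hL : L 1 = 0 := h
  have hLa : L ((1 : ℝ) • a) = 0 := by
    rw [one_smul, show a = a • (1 : ℝ) by simp, L.map_smul, hL, smul_zero]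
  exact hLa

theorem IsHorizontalAt.act {γ : ℝ → P} {t : ℝ} (g : G) (hγ : MDifferentiableAt 𝓘(ℝ, ℝ) IP γ t)
    (h : A.IsHorizontalAt γ t) : A.IsHorizontalAt (fun r => B.act (γ r) g) t := by
  have hR : MDifferentiableAt IP IP (fun p => B.act p g) (γ t) :=
    (B.contMDiff_act_right g).mdifferentiableAt (by simp)
  have hc := hR.hasMFDerivAt.comp t hγ.hasMFDerivAt
  unfold IsHorizontalAt at h ⊢
  change A.form (B.act (γ t) g)
    (mfderiv 𝓘(ℝ, ℝ) IP ((fun p => B.act p g) ∘ γ) t (1 : ℝ)) = 0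
  rw [hc.mfderiv]
  refine (A.form_act (γ t) g _).trans ((congrArg (adjointAction IG g⁻¹) h).trans ?_)
  exact (mfderiv IG IG (fun h : G => g⁻¹ * h * g⁻¹⁻¹) 1).map_zero

theorem IsHorizontal.refl (p : P) : A.IsHorizontal (Path.refl p) := by
  obtain ⟨s, hs⟩ := IsPiecewiseC1.refl IP p
  refine ⟨s, hs, fun t _ _ => ?_⟩
  have hc : mfderiv 𝓘(ℝ, ℝ) IP (fun _ : ℝ => p) t = 0 := mfderiv_const
  change A.form p (mfderiv 𝓘(ℝ, ℝ) IP (fun _ : ℝ => p) t (1 : ℝ)) = 0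
  rw [hc]
  exact (A.form p).map_zero

theorem IsHorizontal.symm {p q : P} {γ : Path p q} (hγ : A.IsHorizontal γ) :
    A.IsHorizontal γ.symm := by
  obtain ⟨s, hs, h⟩ := hγ
  refine ⟨_, by rw [Path.extend_symm]; exact hs.reverse, fun t ht hts => ?_⟩
  have ht' : 1 - t ∈ Ioo (0 : ℝ) 1 := ⟨by linarith [ht.2], by linarith [ht.1]⟩
  have hts' : 1 - t ∉ s := fun hm => hts ⟨1 - t, hm, by ring⟩
  have he : (-1 : ℝ) * t + 1 = 1 - t := by ring
  have := IsHorizontalAt.comp_affine (A := A) (t := t) (γ := γ.extend) (-1) 1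
    (by rw [he]; exact hs.mdifferentiableAt ht' hts') (by rw [he]; exact h _ ht' hts')
  refine this.congr (Filter.Eventually.of_forall fun r => ?_)
  rw [Path.extend_symm_apply, show (1 : ℝ) - r = -1 * r + 1 by ring]

theorem IsHorizontal.trans {p q r : P} {γ : Path p q} {δ : Path q r} (hγ : A.IsHorizontal γ)
    (hδ : A.IsHorizontal δ) : A.IsHorizontal (γ.trans δ) := by
  obtain ⟨s, hs, h⟩ := hγ
  obtain ⟨s', hs', h'⟩ := hδ
  refine ⟨_, hs.concat hs' (fun t ht => Path.extend_trans_of_le_half γ δ ht)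
    (fun t ht => Path.extend_trans_of_half_le γ δ ht), fun t ht hts => ?_⟩
  rcases lt_trichotomy t (1 / 2) with hlt | heq | hgt
  · have ht' : 2 * t ∈ Ioo (0 : ℝ) 1 := ⟨by linarith [ht.1], by linarith⟩
    have hts' : 2 * t ∉ s := fun hm => hts (Or.inr (Or.inl ⟨2 * t, hm, by ring⟩))
    have := IsHorizontalAt.comp_affine (A := A) (t := t) (γ := γ.extend) 2 0
      (by rw [add_zero]; exact hs.mdifferentiableAt ht' hts')
      (by rw [add_zero]; exact h _ ht' hts')
    refine this.congr ?_
    filter_upwards [Iio_mem_nhds hlt] with r hr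
    rw [Path.extend_trans_of_le_half γ δ (le_of_lt hr), add_zero]
  · exact absurd (Or.inl heq) hts
  · have ht' : 2 * t - 1 ∈ Ioo (0 : ℝ) 1 := ⟨by linarith, by linarith [ht.2]⟩
    have hts' : 2 * t - 1 ∉ s' := fun hm => hts (Or.inr (Or.inr ⟨2 * t - 1, hm, by ring⟩))
    have := IsHorizontalAt.comp_affine (A := A) (t := t) (γ := δ.extend) 2 (-1)
      (by rw [← sub_eq_add_neg]; exact hs'.mdifferentiableAt ht' hts')
      (by rw [← sub_eq_add_neg]; exact h' _ ht' hts')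
    refine this.congr ?_
    filter_upwards [Ioi_mem_nhds hgt] with r hr
    rw [Path.extend_trans_of_half_le γ δ (le_of_lt hr), sub_eq_add_neg]

/-- Right translates of horizontal paths are horizontal. -/
theorem IsHorizontal.exists_act {p q : P} {γ : Path p q} (hγ : A.IsHorizontal γ) (g : G) :
    ∃ δ : Path (B.act p g) (B.act q g), A.IsHorizontal δ ∧ ∀ t, δ t = B.act (γ t) g := by
  obtain ⟨s, hs, h⟩ := hγ
  exact ⟨γ.map (B.contMDiff_act_right g).continuous,
    ⟨s, hs.comp_contMDiff ((B.contMDiff_act_right g).of_le (by simp)), fun t ht hts =>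
      (h t ht hts).act g (hs.mdifferentiableAt ht hts)⟩, fun t => rfl⟩

end HolonomyGroup

/-- The holonomy group of the connection with reference point `p₀`: the holonomies of all piecewise
`C¹` loops based at the projection of `p₀`. -/
def holonomyGroup (p₀ : P) : Subgroup G where
  carrier := {g | ∃ c : Path (B.proj p₀) (B.proj p₀), IsPiecewiseC1 IM c ∧ A.IsHolonomy p₀ c g}
  one_mem' := by
    refine ⟨Path.refl _, IsPiecewiseC1.refl IM _,
      (Path.refl p₀).cast rfl (B.act_one p₀), ?_, fun t => rfl⟩
    exact IsHorizontal.refl p₀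
  mul_mem' := by
    rintro a b ⟨c, hc, γ, hγ, hγc⟩ ⟨d, hd, δ, hδ, hδd⟩
    obtain ⟨ε, hε, hεγ⟩ := hγ.exists_act b
    refine ⟨d.trans c, hd.trans hc, (δ.trans ε).cast rfl (B.act_mul p₀ a b), hδ.trans hε, ?_⟩
    intro t
    simp only [Path.cast_coe, Path.trans_apply]
    split_ifs
    · exact hδd _
    · rw [hεγ, B.proj_act, hγc]
  inv_mem' := by
    rintro a ⟨c, hc, γ, hγ, hγc⟩
    obtain ⟨ε, hε, hεγ⟩ := hγ.symm.exists_act a⁻¹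
    refine ⟨c.symm, hc.symm, ε.cast (by rw [← B.act_mul, mul_inv_cancel, B.act_one]) rfl, hε, ?_⟩
    intro t
    simp only [Path.cast_coe, hεγ, B.proj_act, Path.symm_apply]
    exact hγc _

/-- The connection is genuinely non-Abelian: its holonomy group (at some reference point) is
non-Abelian. -/
def IsGenuinelyNonAbelian : Prop :=
  ∃ p₀ : P, ¬ IsMulCommutative (A.holonomyGroup p₀)

end PrincipalConnection

end Connections

end

/-! The first claim is immediate, since a subgroup of an Abelian group is Abelian. For the second,
argue by contraposition: by path-connectedness, an Abelian fundamental group at one base point gives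
one at `B.proj p₀`. If loops `c` and `d` have holonomies `a` and `b`, then `d` followed by `c` lifts
horizontally to a path from `p₀` to `p₀ · ab`, and `c` followed by `d` to one ending at `p₀ · ba`.
The two concatenations are homotopic, so everything rests on `IsFlat.eq_of_homotopic`: the end point
of a horizontal lift depends only on the homotopy class of the base path. Freeness of the action
then gives `ab = ba`.

Homotopy invariance holds because a flat connection turns `P` into a covering of `M` once the fibres
are made discrete. Flatness is the integrability condition of the horizontal distribution, and
Frobenius' theorem (`exists_hasFDerivAt_of_integrable`, applied to the lift from
`exists_horizontalLift`) yields horizontal local sections. A Grönwall estimate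
(`IsFlat.exists_nhds_unique_lift`) shows that horizontal curves with the same projection agree if
they agree at one point. Hence a horizontal curve is locally a fixed right translate of a section
(`IsFlat.eventually_eq_act`), and two sections differ by a locally constant group element
(`IsFlat.eventually_section_eq`). The latter makes the transition functions of
`HorizontalAtlas.bundleCore` continuous for the discrete topology on `G`; the former makes
horizontal paths continuous in the resulting covering, where the homotopy lifting theorem applies
even though homotopies are merely continuous. -/

open scoped NNReal

/-! ### Frobenius' theorem for total differential equations, via ODEs along rays -/

section TotalDifferentialEquations

open Metric

theorem gronwallBound_zero_left (K ε x : ℝ) :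
    gronwallBound 0 K ε x = ε * gronwallBound 0 K 1 x := by
  unfold gronwallBound
  split_ifs <;> ring

variable {E₁ : Type*} [NormedAddCommGroup E₁] [NormedSpace ℝ E₁]
  {E₂ : Type*} [NormedAddCommGroup E₂] [NormedSpace ℝ E₂]

/-- The Picard–Lindelöf theorem on `[0, 1]` for an autonomous equation, with control on the region
in which the solution stays. -/
theorem exists_solution_mem_closedBall [CompleteSpace E₂] {v : E₂ → E₂} {p : E₂} {R K : ℝ≥0}
    (hv : LipschitzOnWith K v (closedBall p R)) (hb : ∀ y ∈ closedBall p R, ‖v y‖ ≤ R) :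
    ∃ y : ℝ → E₂, y 0 = p ∧ ∀ t ∈ Icc (0 : ℝ) 1,
      y t ∈ closedBall p R ∧ HasDerivWithinAt y (v (y t)) (Icc 0 1) t := by
  have hf : IsPicardLindelof (fun _ => v) (⟨0, by simp⟩ : Icc (0 : ℝ) 1) p R 0 R K :=
    IsPicardLindelof.of_time_independent hb hv (by simp)
  have hx : p ∈ closedBall p ((0 : ℝ≥0) : ℝ) := by simp
  -- The Picard fixed point itself is used, because membership in the function space also records
  -- that the curve stays in the ball.
  obtain ⟨α, hα⟩ := ODE.FunSpace.exists_isFixedPt_next hf hx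
  refine ⟨α.compProj, ?_, fun t ht => ⟨α.compProj_mem_closedBall hf.mul_max_le, ?_⟩⟩
  · have h0 := ODE.FunSpace.next_apply₀ hf hx α
    rw [hα] at h0
    exact (ODE.FunSpace.compProj_val (α := α) (t := (⟨0, by simp⟩ : Icc (0 : ℝ) 1))).trans h0
  · refine (ODE.hasDerivWithinAt_picard_Icc (t₀ := 0) (by simp) hf.continuousOn_uncurry
      α.continuous_compProj.continuousOn (fun _ _ => α.compProj_mem_closedBall hf.mul_max_le)
      p ht).congr_of_mem (fun t' ht' => ?_) ht
    nth_rw 1 [← hα]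
    rw [ODE.FunSpace.compProj_of_mem ht', ODE.FunSpace.next_apply]

/-- If `y` solves `y' = F(y)h` and `F` satisfies the integrability condition, then
`y + tF(y)k` solves `z' = F(z)(h + k)` up to an error that is quadratic in `k`. -/
theorem dist_radial_solutions_le {F : E₂ → E₁ →L[ℝ] E₂} {p : E₂} {R r C D : ℝ} {K L : ℝ≥0}
    (hd : ∀ y ∈ closedBall p R, HasFDerivAt F (fderiv ℝ F y) y)
    (hK : LipschitzOnWith K F (closedBall p R))
    (hL : LipschitzOnWith L (fderiv ℝ F) (closedBall p R))
    (hC : ∀ y ∈ closedBall p R, ‖F y‖ ≤ C) (hD : ∀ y ∈ closedBall p R, ‖fderiv ℝ F y‖ ≤ D)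
    (hs : ∀ y ∈ closedBall p R, ∀ h k, fderiv ℝ F y (F y h) k = fderiv ℝ F y (F y k) h)
    (hr : C * r ≤ R / 2) {h k : E₁} (hh : ‖h‖ ≤ r) (hk : ‖k‖ ≤ r) {y z : ℝ → E₂}
    (hy0 : y 0 = p) (hz0 : z 0 = p)
    (hy : ∀ t ∈ Icc (0 : ℝ) 1, y t ∈ closedBall p (R / 2) ∧
      HasDerivWithinAt y (F (y t) h) (Icc 0 1) t)
    (hz : ∀ t ∈ Icc (0 : ℝ) 1, z t ∈ closedBall p (R / 2) ∧
      HasDerivWithinAt z (F (z t) (h + k)) (Icc 0 1) t) :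
    ‖z 1 - y 1 - F (y 1) k‖ ≤
      (D * C + L * C ^ 2 * (2 * r)) * gronwallBound 0 (K * (2 * r)) 1 1 * ‖k‖ ^ 2 := by
  have hr0 : 0 ≤ r := (norm_nonneg h).trans hh
  have hR0 : 0 ≤ R / 2 := dist_nonneg.trans (hy 0 (by simp)).1
  have hsub : closedBall p (R / 2) ⊆ closedBall p R := closedBall_subset_closedBall (by linarith)
  have hC0 : 0 ≤ C := (norm_nonneg _).trans (hC p (by simp; linarith))
  have hD0 : 0 ≤ D := (norm_nonneg (fderiv ℝ F p)).trans (hD p (by simp; linarith))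
  set ε : ℝ := (D * C + L * C ^ 2 * (2 * r)) * ‖k‖ ^ 2 with hε
  -- This is the first-order guess for the solution in direction `h + k`; the plan is to bound its
  -- defect by `ε` and compare it with `z` by Grönwall.
  let w : ℝ → E₂ := fun t => y t + t • F (y t) k
  let w' : ℝ → E₂ := fun t =>
    F (y t) h + (t • fderiv ℝ F (y t) (F (y t) h) k + (1 : ℝ) • F (y t) k)
  have hhk : ‖h + k‖ ≤ 2 * r := (norm_add_le _ _).trans (by linarith)
  have hFk : ∀ t ∈ Icc (0 : ℝ) 1, ‖t • F (y t) k‖ ≤ C * ‖k‖ := fun t ht => by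
    rw [norm_smul, Real.norm_of_nonneg ht.1]
    calc t * ‖F (y t) k‖ ≤ 1 * (‖F (y t)‖ * ‖k‖) :=
          mul_le_mul ht.2 ((F (y t)).le_opNorm k) (norm_nonneg _) zero_le_one
      _ ≤ C * ‖k‖ := by
          rw [one_mul]; gcongr; exact hC _ (hsub (hy t ht).1)
  have hwm : ∀ t ∈ Icc (0 : ℝ) 1, w t ∈ closedBall p R := fun t ht => by
    rw [mem_closedBall, dist_eq_norm]
    have h1 : ‖y t - p‖ ≤ R / 2 := by simpa [dist_eq_norm] using (hy t ht).1
    have h2 : C * ‖k‖ ≤ C * r := by gcongr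
    calc ‖w t - p‖ = ‖(y t - p) + t • F (y t) k‖ := by congr 1; simp only [w]; abel
      _ ≤ ‖y t - p‖ + ‖t • F (y t) k‖ := norm_add_le _ _
      _ ≤ R := by linarith [hFk t ht]
  have hwd : ∀ t ∈ Icc (0 : ℝ) 1, HasDerivWithinAt w (w' t) (Icc 0 1) t := fun t ht => by
    have h1 := ((hd _ (hsub (hy t ht).1)).comp_hasDerivWithinAt t (hy t ht).2).clm_apply
      (hasDerivWithinAt_const t (Icc (0 : ℝ) 1) k)
    have h2 := (hasDerivWithinAt_id t (Icc (0 : ℝ) 1)).smul h1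
    have h3 := (hy t ht).2.add h2
    simp only [map_zero, add_zero] at h3
    exact h3
  have hIci : ∀ {f : ℝ → E₂} {f' : E₂} {t : ℝ}, t ∈ Ico (0 : ℝ) 1 →
      HasDerivWithinAt f f' (Icc 0 1) t → HasDerivWithinAt f f' (Ici t) t := fun ht hf =>
    hf.mono_of_mem_nhdsWithin (Filter.mem_of_superset (Icc_mem_nhdsGE ht.2)
      (Icc_subset_Icc_left ht.1))
  have hbound : ∀ t ∈ Icc (0 : ℝ) 1, dist (w' t) (F (w t) (h + k)) ≤ ε := fun t ht => by
    have hym := hsub (hy t ht).1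
    have hseg : segment ℝ (y t) (w t) ⊆ closedBall p R :=
      (convex_closedBall p R).segment_subset hym (hwm t ht)
    have hwy : w t - y t = t • F (y t) k := by simp [w]
    have hρ : ‖F (w t) - F (y t) - fderiv ℝ F (y t) (w t - y t)‖ ≤
        (L * (C * ‖k‖)) * ‖w t - y t‖ := by
      refine (convex_segment (y t) (w t)).norm_image_sub_le_of_norm_hasFDerivWithin_le'
        (fun x hx => (hd x (hseg hx)).hasFDerivWithinAt) (fun x hx => ?_)
        (left_mem_segment ℝ _ _) (right_mem_segment ℝ _ _)
      have h1 := hL.dist_le_mul x (hseg hx) (y t) hym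
      rw [dist_eq_norm, dist_eq_norm] at h1
      refine h1.trans ?_
      gcongr
      refine le_trans ?_ (hFk t ht)
      rw [← hwy]
      exact norm_sub_le_of_mem_segment hx
    -- Integrability enters here: it cancels the only term of the defect that is linear in `k`. What
    -- remains is bounded by `e1` and `e2`, both quadratic in `k`.
    have hsy : fderiv ℝ F (y t) (w t - y t) h = t • fderiv ℝ F (y t) (F (y t) h) k := by
      rw [hwy, map_smul, hs _ hym h k]; rfl
    have key : w' t - F (w t) (h + k) = -(fderiv ℝ F (y t) (w t - y t) k +
        (F (w t) - F (y t) - fderiv ℝ F (y t) (w t - y t)) (h + k)) := by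
      simp only [w', ← hsy, map_add, sub_apply, one_smul]
      abel
    rw [dist_eq_norm, key, norm_neg]
    have hn : ‖w t - y t‖ ≤ C * ‖k‖ := hwy ▸ hFk t ht
    have e1 : ‖fderiv ℝ F (y t) (w t - y t) k‖ ≤ D * (C * ‖k‖) * ‖k‖ :=
      (ContinuousLinearMap.le_opNorm₂ _ _ _).trans (by gcongr; exact hD _ hym)
    have e2 : ‖(F (w t) - F (y t) - fderiv ℝ F (y t) (w t - y t)) (h + k)‖ ≤
        (L * (C * ‖k‖)) * (C * ‖k‖) * (2 * r) :=
      (ContinuousLinearMap.le_opNorm _ _).trans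
        (mul_le_mul (hρ.trans (by gcongr)) hhk (norm_nonneg _) (by positivity))
    refine (norm_add_le _ _).trans ((add_le_add e1 e2).trans (le_of_eq ?_))
    rw [hε]; ring
  obtain ⟨K', hK'⟩ : ∃ K' : ℝ≥0, (K' : ℝ) = K * (2 * r) := ⟨⟨K * (2 * r), by positivity⟩, rfl⟩
  have hv : ∀ t ∈ Ico (0 : ℝ) 1, LipschitzOnWith K'
      (fun y => F y (h + k)) (closedBall p R) := fun t _ => by
    refine LipschitzOnWith.of_dist_le_mul fun a ha b hb => ?_
    have h1 := hK.dist_le_mul a ha b hb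
    rw [dist_eq_norm] at h1 ⊢
    rw [← sub_apply]
    refine (ContinuousLinearMap.le_opNorm _ _).trans
      ((mul_le_mul h1 hhk (norm_nonneg _) (by positivity)).trans (le_of_eq ?_))
    rw [hK']; ring
  have := dist_le_of_approx_trajectories_ODE_of_mem (v := fun _ y => F y (h + k))
    (s := fun _ => closedBall p R) (f := z) (g := w) (f' := fun t => F (z t) (h + k)) (g' := w')
    (εf := 0) (εg := ε) (δ := 0) hv (fun t ht => (hz t ht).2.continuousWithinAt)
    (fun t ht => hIci ht (hz t (Ico_subset_Icc_self ht)).2) (fun t _ => by simp)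
    (fun t ht => hsub (hz t (Ico_subset_Icc_self ht)).1)
    (fun t ht => (hwd t ht).continuousWithinAt)
    (fun t ht => hIci ht (hwd t (Ico_subset_Icc_self ht)))
    (fun t ht => hbound t (Ico_subset_Icc_self ht))
    (fun t ht => hwm t (Ico_subset_Icc_self ht)) (by simp [w, hy0, hz0]) 1 (by simp)
  rw [dist_eq_norm, zero_add, sub_zero, gronwallBound_zero_left, hK'] at this
  simp only [w, one_smul] at this
  rw [sub_sub]
  refine this.trans (le_of_eq ?_)
  rw [hε]; ring

/-- **Frobenius' theorem for total differential equations** `Dσ(x) = F(σ(x))`: if `F` is `C²` and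
satisfies the integrability condition, there is a local solution with a given value at a given
point. -/
theorem exists_hasFDerivAt_of_integrable [CompleteSpace E₂] {F : E₂ → E₁ →L[ℝ] E₂} {p : E₂}
    (x₀ : E₁) (hF : ContDiffAt ℝ 2 F p)
    (hs : ∀ᶠ y in 𝓝 p, ∀ h k, fderiv ℝ F y (F y h) k = fderiv ℝ F y (F y k) h)
    {N : Set E₂} (hN : N ∈ 𝓝 p) :
    ∃ r > 0, ∃ σ : E₁ → E₂, σ x₀ = p ∧
      ∀ x ∈ ball x₀ r, σ x ∈ N ∧ HasFDerivAt σ (F (σ x)) x := by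
  obtain ⟨K, sK, hsK, hK⟩ := (hF.of_le one_le_two).exists_lipschitzOnWith
  have hF' : ContDiffAt ℝ 1 (fderiv ℝ F) p := hF.fderiv_right (m := 1) (by norm_num)
  obtain ⟨L, sL, hsL, hL⟩ := hF'.exists_lipschitzOnWith
  have hd : ∀ᶠ y in 𝓝 p, HasFDerivAt F (fderiv ℝ F y) y :=
    (hF.eventually (by decide)).mono fun y hy => (hy.differentiableAt (by simp)).hasFDerivAt
  have hC : ∀ᶠ y in 𝓝 p, ‖F y‖ < ‖F p‖ + 1 :=
    hF.continuousAt.norm.eventually_lt continuousAt_const (lt_add_one _)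
  have hD : ∀ᶠ y in 𝓝 p, ‖fderiv ℝ F y‖ < ‖fderiv ℝ F p‖ + 1 :=
    ContinuousAt.eventually_lt (f := fun y => ‖fderiv ℝ F y‖)
      (ContinuousAt.norm (E := E₂ →L[ℝ] E₁ →L[ℝ] E₂) hF'.continuousAt)
      continuousAt_const (lt_add_one _)
  obtain ⟨R, hR, hball⟩ := nhds_basis_closedBall.mem_iff.1
    (hs.and (hd.and (hC.and (hD.and (Filter.eventually_of_mem hN fun _ h => h)))) |>.and
      ((Filter.eventually_of_mem hsK fun _ h => h).and (Filter.eventually_of_mem hsL fun _ h => h)))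
  set C := ‖F p‖ + 1
  set D := ‖fderiv ℝ F p‖ + 1
  have hC0 : 0 < C := by positivity
  have hsub : closedBall p (R / 2) ⊆ closedBall p R := closedBall_subset_closedBall (by linarith)
  -- Speed at most `C * r = R / 2` keeps solutions in the half ball up to time 1, which leaves room
  -- for the perturbed curve `y + tF(y)k` in the full ball.
  let r : ℝ := R / 2 / C
  have hr : 0 < r := by positivity
  have hCr : C * r = R / 2 := by simp only [r]; field_simp
  have hsol : ∀ h : E₁, ∃ y : ℝ → E₂, ‖h‖ < r → y 0 = p ∧ ∀ t ∈ Icc (0 : ℝ) 1,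
      y t ∈ closedBall p (R / 2) ∧ HasDerivWithinAt y (F (y t) h) (Icc 0 1) t := by
    intro h
    by_cases hh : ‖h‖ < r
    · obtain ⟨y, hy⟩ := exists_solution_mem_closedBall (v := fun y => F y h) (p := p)
        (R := ⟨R / 2, by positivity⟩) (K := K * ‖h‖₊) (by
          refine LipschitzOnWith.of_dist_le_mul fun a ha b hb => ?_
          have h1 := hK.dist_le_mul a (hball (hsub ha)).2.1 b (hball (hsub hb)).2.1
          rw [dist_eq_norm] at h1 ⊢
          rw [← sub_apply]
          refine (ContinuousLinearMap.le_opNorm _ _).trans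
            ((mul_le_mul_of_nonneg_right h1 (norm_nonneg _)).trans (le_of_eq ?_))
          simp only [NNReal.coe_mul, coe_nnnorm]; ring) (by
          intro y hy
          refine (ContinuousLinearMap.le_opNorm _ _).trans ?_
          refine (mul_le_mul (hball (hsub hy)).1.2.2.1.le hh.le (norm_nonneg _) hC0.le).trans ?_
          exact hCr.le)
      exact ⟨y, fun _ => hy⟩
    · exact ⟨0, fun h' => absurd h' hh⟩
  choose Y hY using hsol
  -- The solution at `x` is the time-one value along the ray from `x₀` to `x`. At `x₀` the direction
  -- is zero, so the ODE solution is constant.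
  refine ⟨r, hr, fun x => Y (x - x₀) 1, ?_, fun x hx => ?_⟩
  · have h0 := hY 0 (by simpa using hr)
    have hconst := constant_of_has_deriv_right_zero (f := Y 0) (a := 0) (b := 1)
      (fun t ht => (h0.2 t ht).2.continuousWithinAt) (fun t ht => by
        have := (h0.2 t (Ico_subset_Icc_self ht)).2
        rw [map_zero] at this
        exact this.mono_of_mem_nhdsWithin (Filter.mem_of_superset (Icc_mem_nhdsGE ht.2)
          (Icc_subset_Icc_left ht.1))) 1 (by simp)
    simp only [sub_self]
    rw [hconst, h0.1]
  have hxr : ‖x - x₀‖ < r := by simpa [dist_eq_norm] using hx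
  refine ⟨(hball (hsub ((hY _ hxr).2 1 (by simp)).1)).1.2.2.2.2, ?_⟩
  rw [hasFDerivAt_iff_isLittleO_nhds_zero]
  refine (Asymptotics.IsBigO.of_bound ((D * C + L * C ^ 2 * (2 * r)) *
    gronwallBound 0 (K * (2 * r)) 1 1) ?_).trans_isLittleO
      (Asymptotics.isLittleO_norm_pow_id one_lt_two)
  have hev : ∀ᶠ k : E₁ in 𝓝 0, ‖x - x₀ + k‖ < r ∧ ‖k‖ < r := by
    refine Filter.Eventually.and ?_ ?_
    · exact (by fun_prop : Continuous fun k : E₁ => ‖x - x₀ + k‖).continuousAt.eventually_lt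
        continuousAt_const (by simpa using hxr)
    · exact (by fun_prop : Continuous fun k : E₁ => ‖k‖).continuousAt.eventually_lt
        continuousAt_const (by simpa using hr)
  filter_upwards [hev] with k hk
  rw [norm_pow, norm_norm, show x + k - x₀ = x - x₀ + k by abel]
  exact dist_radial_solutions_le (fun y hy => (hball hy).1.2.1)
    (hK.mono fun y hy => (hball hy).2.1) (hL.mono fun y hy => (hball hy).2.2)
    (fun y hy => (hball hy).1.2.2.1.le) (fun y hy => (hball hy).1.2.2.2.1.le)
    (fun y hy => (hball hy).1.1) hCr.le hxr.le hk.2.le (hY _ hxr).1 (hY _ hk.1).1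
    (hY _ hxr).2 (hY _ hk.1).2

end TotalDifferentialEquations

/-! ### The horizontal lift of vectors and its integrability -/

section HorizontalLifts

variable {E₁ : Type*} [NormedAddCommGroup E₁] [NormedSpace ℝ E₁]
  {E₂ : Type*} [NormedAddCommGroup E₂] [NormedSpace ℝ E₂] [FiniteDimensional ℝ E₂]
  {E₃ : Type*} [NormedAddCommGroup E₃] [NormedSpace ℝ E₃]

/-- For a submersion `f` and a form `α` whose kernel is complementary to that of `df`, the lift of
vectors from the base to the kernel of `α` is smooth. If `dα` vanishes on the kernel of `α`, this
lift satisfies the integrability condition. -/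
theorem exists_horizontalLift {O : Set E₂} (hO : IsOpen O) {f : E₂ → E₁} (hf : ContDiffOn ℝ ∞ f O)
    {α : E₂ → E₂ →L[ℝ] E₃} (hα : ContDiffOn ℝ ∞ α O)
    (hb : ∀ z ∈ O, Function.Bijective ((fderiv ℝ f z).prod (α z)))
    (hflat : ∀ z ∈ O, ∀ u v, α z u = 0 → α z v = 0 → fderiv ℝ α z u v = fderiv ℝ α z v u) :
    ∃ F : E₂ → E₁ →L[ℝ] E₂, ∀ z ∈ O, ContDiffAt ℝ ∞ F z ∧
      (∀ v, fderiv ℝ f z (F z v) = v) ∧ (∀ v, α z (F z v) = 0) ∧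
      (∀ w, α z w = 0 → F z (fderiv ℝ f z w) = w) ∧
      ∀ h k, fderiv ℝ F z (F z h) k = fderiv ℝ F z (F z k) h := by
  have := FiniteDimensional.complete ℝ E₂
  have hf' : ContDiffOn ℝ ∞ (fderiv ℝ f) O := hf.fderiv_of_isOpen hO (by simp)
  let T : E₂ → E₂ →L[ℝ] E₁ × E₃ := fun z => (fderiv ℝ f z).prod (α z)
  have hT : ContDiffOn ℝ ∞ T O := by
    have : T = fun z => (ContinuousLinearMap.inl ℝ E₁ E₃).comp (fderiv ℝ f z) +
        (ContinuousLinearMap.inr ℝ E₁ E₃).comp (α z) := by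
      ext z w <;> simp [T]
    rw [this]
    exact (contDiffOn_const.clm_comp hf').add (contDiffOn_const.clm_comp hα)
  have hinv : ∀ z ∈ O, (T z).IsInvertible := fun z hz => by
    let e := LinearEquiv.ofBijective (T z : E₂ →ₗ[ℝ] E₁ × E₃) (hb z hz)
    have : FiniteDimensional ℝ (E₁ × E₃) := Module.Finite.equiv e
    exact ⟨e.toContinuousLinearEquiv, by ext w <;> rfl⟩
  -- The lift of `v` is the unique vector over `v` in the kernel of `α`; it is smooth in `z` because
  -- inversion of linear maps is.
  let F : E₂ → E₁ →L[ℝ] E₂ := fun z => (T z).inverse.comp (ContinuousLinearMap.inl ℝ E₁ E₃)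
  have hF : ∀ z ∈ O, ContDiffAt ℝ ∞ F z := fun z hz =>
    ((hinv z hz).contDiffAt_map_inverse.comp z (hT.contDiffAt (hO.mem_nhds hz))).clm_comp
      contDiffAt_const
  have hTF : ∀ z ∈ O, ∀ v, T z (F z v) = (v, 0) := fun z hz v => by
    obtain ⟨e, he⟩ := hinv z hz
    simp [F, ← he]
  have h1 : ∀ z ∈ O, ∀ v, fderiv ℝ f z (F z v) = v := fun z hz v =>
    congrArg Prod.fst (hTF z hz v)
  have h2 : ∀ z ∈ O, ∀ v, α z (F z v) = 0 := fun z hz v => congrArg Prod.snd (hTF z hz v)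
  refine ⟨F, fun z hz => ⟨hF z hz, h1 z hz, h2 z hz, fun w hw => ?_, fun h k => ?_⟩⟩
  · exact (hb z hz).1 ((hTF z hz _).trans (Prod.ext rfl hw.symm))
  have hFd : DifferentiableAt ℝ F z := (hF z hz).differentiableAt (by simp)
  have hαd : DifferentiableAt ℝ α z :=
    (hα.contDiffAt (hO.mem_nhds hz)).differentiableAt (by simp)
  have hfd : DifferentiableAt ℝ (fderiv ℝ f) z :=
    (hf'.contDiffAt (hO.mem_nhds hz)).differentiableAt (by simp)
  -- `d1` and `d2` differentiate the two defining identities of the lift in the direction `u`. With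
  -- `u` itself a lift, the symmetry of the second derivative of `f` and the closedness of `α` on
  -- its kernel show that both sides of the integrability condition have the same image under the
  -- injective map `T z`.
  have d1 : ∀ u v, fderiv ℝ (fderiv ℝ f) z u (F z v) + fderiv ℝ f z (fderiv ℝ F z u v) = 0 := by
    intro u v
    have hd := hfd.hasFDerivAt.clm_apply (hFd.hasFDerivAt.clm_apply (hasFDerivAt_const v z))
    have hc : HasFDerivAt (fun z => fderiv ℝ f z (F z v)) (0 : E₂ →L[ℝ] E₁) z :=
      (hasFDerivAt_const v z).congr_of_eventuallyEq
        (Filter.eventually_of_mem (hO.mem_nhds hz) fun y hy => h1 y hy v)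
    have := congrArg (fun L => L u) (hd.unique hc)
    simpa [add_comm] using this
  have d2 : ∀ u v, fderiv ℝ α z u (F z v) + α z (fderiv ℝ F z u v) = 0 := by
    intro u v
    have hd := hαd.hasFDerivAt.clm_apply (hFd.hasFDerivAt.clm_apply (hasFDerivAt_const v z))
    have hc : HasFDerivAt (fun z => α z (F z v)) (0 : E₂ →L[ℝ] E₃) z :=
      (hasFDerivAt_const 0 z).congr_of_eventuallyEq
        (Filter.eventually_of_mem (hO.mem_nhds hz) fun y hy => h2 y hy v)
    have := congrArg (fun L => L u) (hd.unique hc)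
    simpa [add_comm] using this
  have hsym : IsSymmSndFDerivAt ℝ f z :=
    (hf.contDiffAt (hO.mem_nhds hz)).isSymmSndFDerivAt (by
      rw [minSmoothness_of_isRCLikeNormedField]; exact WithTop.coe_le_coe.2 le_top)
  refine (hb z hz).1 (Prod.ext ?_ ?_)
  · have e1 := d1 (F z h) k
    rw [hsym.eq (F z h) (F z k)] at e1
    exact add_left_cancel (e1.trans (d1 (F z k) h).symm)
  · have e1 := d2 (F z h) k
    rw [hflat z hz (F z h) (F z k) (h2 z hz h) (h2 z hz k)] at e1
    exact add_left_cancel (e1.trans (d2 (F z k) h).symm)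

end HorizontalLifts

/-- A `π`-preimage can be corrected within the kernel of `π` to have any prescribed value of `α`, so
the pair is onto. Surjectivity forces the opposite dimension inequality, and equal dimensions give
injectivity. -/
theorem bijective_prod_of_rightInverse {E₁ E₂ E₃ : Type*} [NormedAddCommGroup E₁] [NormedSpace ℝ E₁]
    [NormedAddCommGroup E₂] [NormedSpace ℝ E₂] [NormedAddCommGroup E₃] [NormedSpace ℝ E₃]
    [FiniteDimensional ℝ E₁] [FiniteDimensional ℝ E₂] [FiniteDimensional ℝ E₃]
    {π : E₂ →L[ℝ] E₁} {α : E₂ →L[ℝ] E₃}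
    (hfin : Module.finrank ℝ E₂ ≤ Module.finrank ℝ (E₁ × E₃)) (hπ : Function.Surjective π)
    (hα : ∀ η, ∃ u, π u = 0 ∧ α u = η) : Function.Bijective (π.prod α) := by
  have hsurj : Function.Surjective (π.prod α) := by
    rintro ⟨v, ξ⟩
    obtain ⟨u, hu⟩ := hπ v
    obtain ⟨u', h1, h2⟩ := hα (ξ - α u)
    exact ⟨u + u', by simp [hu, h1, h2]⟩
  have hfin' := le_antisymm hfin
    (LinearMap.finrank_le_finrank_of_surjective (f := (π.prod α : E₂ →ₗ[ℝ] E₁ × E₃)) hsurj)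
  exact ⟨(LinearMap.injective_iff_surjective_of_finrank_eq_finrank
    (f := (π.prod α : E₂ →ₗ[ℝ] E₁ × E₃)) hfin').2 hsurj, hsurj⟩

/-! ### The fibres of a principal bundle and the splitting of its tangent spaces -/

section PrincipalBundles

variable {EM : Type*} [NormedAddCommGroup EM] [NormedSpace ℝ EM]
  {HM : Type*} [TopologicalSpace HM] {IM : ModelWithCorners ℝ EM HM}
  {EG : Type*} [NormedAddCommGroup EG] [NormedSpace ℝ EG]
  {HG : Type*} [TopologicalSpace HG] {IG : ModelWithCorners ℝ EG HG}
  {EP : Type*} [NormedAddCommGroup EP] [NormedSpace ℝ EP]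
  {HP : Type*} [TopologicalSpace HP] {IP : ModelWithCorners ℝ EP HP}
  {M : Type*} [TopologicalSpace M] [ChartedSpace HM M]
  {G : Type*} [TopologicalSpace G] [ChartedSpace HG G] [Group G]
  {P : Type*} [TopologicalSpace P] [ChartedSpace HP P]

namespace PrincipalBundle

variable (B : PrincipalBundle IM IG IP M G P)

/-- The structure group acts freely. -/
theorem act_right_injective (p : P) : Function.Injective (B.act p) := fun g h hgh => by
  obtain ⟨e, he, -, -, hact⟩ := B.exists_trivialization (B.proj p)
  have hp : p ∈ e.source := e.mem_source.2 he
  have := congrArg (fun q => (e q).2) hgh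
  simpa only [hact p hp, mul_right_inj] using this

/-- The structure group acts transitively on the fibres. -/
theorem exists_act_eq {p q : P} (h : B.proj p = B.proj q) : ∃ g, B.act p g = q := by
  obtain ⟨e, he, -, -, hact⟩ := B.exists_trivialization (B.proj p)
  have hp : p ∈ e.source := e.mem_source.2 he
  have hq : q ∈ e.source := e.mem_source.2 (h ▸ he)
  have hpg : B.act p ((e p).2⁻¹ * (e q).2) ∈ e.source := e.mem_source.2 (by rwa [B.proj_act])
  refine ⟨(e p).2⁻¹ * (e q).2, e.injOn hpg hq (Prod.ext ?_ ?_)⟩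
  · exact (e.coe_fst hpg).trans ((B.proj_act _ _).trans (h.trans (e.coe_fst hq).symm))
  · exact (hact p hp _).trans (mul_inv_cancel_left _ _)

/-- The differential of the projection as a map between the model spaces. -/
noncomputable def projDeriv (q : P) : EP →L[ℝ] EM := mfderiv IP IM B.proj q

/-- A local section through `q`, with constant group coordinate in a trivialization, provides a
right inverse of the differential. -/
theorem surjective_mfderiv_proj (q : P) : Function.Surjective (mfderiv IP IM B.proj q) := by
  obtain ⟨e, he, -, hsymm, -⟩ := B.exists_trivialization (B.proj q)
  have hq : q ∈ e.source := e.mem_source.2 he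
  let s : M → P := fun y => e.toOpenPartialHomeomorph.symm (y, (e q).2)
  have hsq : s (B.proj q) = q := by
    have : (B.proj q, (e q).2) = e q := Prod.ext (e.coe_fst hq).symm rfl
    simp only [s, this]
    exact e.left_inv hq
  have hmem : ∀ y ∈ e.baseSet, (y, (e q).2) ∈ e.target := fun y hy => e.mem_target.2 hy
  have hs : MDifferentiableAt IM IP s (B.proj q) :=
    ((hsymm.contMDiffAt (e.open_target.mem_nhds (hmem _ he))).comp (B.proj q)
      (contMDiffAt_id.prodMk contMDiffAt_const)).mdifferentiableAt (by simp)
  have hπ : MDifferentiableAt IP IM B.proj (s (B.proj q)) :=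
    B.contMDiff_proj.mdifferentiableAt (by simp)
  have hc := hπ.hasMFDerivAt.comp (B.proj q) hs.hasMFDerivAt
  have hid : B.proj ∘ s =ᶠ[𝓝 (B.proj q)] id :=
    Filter.eventually_of_mem (e.open_baseSet.mem_nhds he) fun y hy =>
      e.proj_symm_apply (hmem y hy)
  have heq := (hc.congr_of_eventuallyEq hid.symm).mfderiv
  rw [mfderiv_id] at heq
  have key : Function.Surjective (mfderiv IP IM B.proj (s (B.proj q))) := fun v =>
    ⟨mfderiv IM IP s (B.proj q) v, (congrArg (fun L : EM →L[ℝ] EM => L v) heq).symm⟩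
  exact hsq ▸ key

theorem mfderiv_proj_fundamental [IsManifold IG ∞ G] (p : P) (ξ : GroupLieAlgebra IG G) :
    mfderiv IP IM B.proj p (B.fundamental p ξ) = 0 := by
  have hact : MDifferentiableAt IG IP (B.act p) 1 :=
    (B.contMDiff_act.comp (contMDiff_const.prodMk contMDiff_id) :
      ContMDiff IG IP ∞ fun g => B.act p g).mdifferentiableAt (by simp)
  have hπ : MDifferentiableAt IP IM B.proj (B.act p 1) :=
    B.contMDiff_proj.mdifferentiableAt (by simp)
  have hc := hπ.hasMFDerivAt.comp (1 : G) hact.hasMFDerivAt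
  have heq : B.proj ∘ B.act p = fun _ => B.proj p := funext fun g => B.proj_act p g
  rw [heq] at hc
  have h0 := hc.mfderiv
  rw [mfderiv_const] at h0
  -- The chain rule gives the derivative at `B.act p 1`, which equals `p` only propositionally; on
  -- the model spaces the statement can be transported.
  have aux : ∀ q, q = p → ∀ u : EP, (mfderiv IP IM B.proj q : EP →L[ℝ] EM) u = 0 →
      (mfderiv IP IM B.proj p : EP →L[ℝ] EM) u = 0 := by
    rintro _ rfl u hu
    exact hu
  exact aux _ (B.act_one p) _ (congrArg (fun L : EG →L[ℝ] EM => L ξ) h0).symm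

/-- The derivative of a trivialization is injective, having that of the inverse trivialization as a
left inverse. -/
theorem finrank_totalSpace_le (B : PrincipalBundle IM IG IP M G P) [FiniteDimensional ℝ EM]
    [FiniteDimensional ℝ EG] (q : P) :
    Module.finrank ℝ EP ≤ Module.finrank ℝ (EM × EG) := by
  obtain ⟨e, he, hsm, hsymm, -⟩ := B.exists_trivialization (B.proj q)
  have hq : q ∈ e.source := e.mem_source.2 he
  have h1 : MDifferentiableAt IP (IM.prod IG) e q :=
    (hsm.contMDiffAt (e.open_source.mem_nhds hq)).mdifferentiableAt (by simp)
  have h2 : MDifferentiableAt (IM.prod IG) IP e.toOpenPartialHomeomorph.symm (e q) :=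
    (hsymm.contMDiffAt (e.open_target.mem_nhds (e.map_source hq))).mdifferentiableAt (by simp)
  have hc := h2.hasMFDerivAt.comp q h1.hasMFDerivAt
  have hid : e.toOpenPartialHomeomorph.symm ∘ e =ᶠ[𝓝 q] id :=
    Filter.eventually_of_mem (e.open_source.mem_nhds hq) fun y hy => e.left_inv hy
  have heq := (hc.congr_of_eventuallyEq hid.symm).mfderiv
  rw [mfderiv_id] at heq
  let L : EP →L[ℝ] EM × EG := mfderiv IP (IM.prod IG) e q
  let L' : EM × EG →L[ℝ] EP :=
    mfderiv (IM.prod IG) IP e.toOpenPartialHomeomorph.symm (e q)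
  have hLL : ∀ u, L' (L u) = u := fun u => (congrArg (fun L : EP →L[ℝ] EP => L u) heq).symm
  exact LinearMap.finrank_le_finrank_of_injective (f := (L : EP →ₗ[ℝ] EM × EG))
    (Function.LeftInverse.injective hLL)

end PrincipalBundle

namespace PrincipalConnection

variable {B : PrincipalBundle IM IG IP M G P} (A : PrincipalConnection B)

/-- The connection form at a point as a map between the model spaces. -/
noncomputable def formAt (q : P) : EP →L[ℝ] EG := A.form q

/-- The differential of the projection and the connection form together identify the tangent spaces
of the total space with the product of those of the base and the Lie algebra. -/
theorem bijective_mfderiv_proj_prod_form [FiniteDimensional ℝ EM] [FiniteDimensional ℝ EG]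
    [FiniteDimensional ℝ EP] [IsManifold IG ∞ G] (q : P) :
    Function.Bijective ((B.projDeriv q).prod (A.formAt q)) :=
  bijective_prod_of_rightInverse (E₁ := EM) (E₂ := EP) (E₃ := EG) (B.finrank_totalSpace_le q)
    (B.surjective_mfderiv_proj q)
    (fun η => ⟨B.fundamental q η, B.mfderiv_proj_fundamental q η, A.form_fundamental q η⟩)

end PrincipalConnection

/-- This removes the bracket term of the curvature on two horizontal vectors. Going through the zero
invariant vector field avoids any compatibility between the group and manifold structures. -/
theorem GroupLieAlgebra.zero_bracket_zero :
    ⁅(0 : GroupLieAlgebra IG G), (0 : GroupLieAlgebra IG G)⁆ = 0 := by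
  have h0 : mulInvariantVectorField (0 : GroupLieAlgebra IG G) = 0 := by
    ext g
    exact (mfderiv IG IG (g * ·) (1 : G)).map_zero
  rw [GroupLieAlgebra.bracket_def, h0, VectorField.mlieBracket_zero_left]
  rfl

/-! ### Derivatives of charts as mutually inverse maps of the model space -/

section Charts

variable {E : Type*} [NormedAddCommGroup E] [NormedSpace ℝ E]
  {H : Type*} [TopologicalSpace H] (I : ModelWithCorners ℝ E H)
  {X : Type*} [TopologicalSpace X] [ChartedSpace H X]

/-- The derivative of a chart as a map between the model spaces. -/
noncomputable def chartDeriv (x y : X) : E →L[ℝ] E := mfderiv I 𝓘(ℝ, E) (extChartAt I x) y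

/-- The derivative of the inverse of a chart as a map between the model spaces. -/
noncomputable def chartSymmDeriv (x : X) (z : E) : E →L[ℝ] E :=
  mfderiv 𝓘(ℝ, E) I (extChartAt I x).symm z

variable [IsManifold I ∞ X]

theorem mdifferentiableAt_extChartAt_of_mem {x y : X} (hy : y ∈ (extChartAt I x).source) :
    MDifferentiableAt I 𝓘(ℝ, E) (extChartAt I x) y := by
  have : IsManifold I 1 X := IsManifold.of_le (n := ∞) (by simp)
  exact mdifferentiableAt_extChartAt (I := I) (by rwa [extChartAt_source] at hy)

variable [I.Boundaryless]

theorem mdifferentiableAt_extChartAt_symm {x : X} {z : E} (hz : z ∈ (extChartAt I x).target) :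
    MDifferentiableAt 𝓘(ℝ, E) I (extChartAt I x).symm z := by
  have := (contMDiffOn_extChartAt_symm (I := I) (n := ∞) x).contMDiffAt
    ((isOpen_extChartAt_target x).mem_nhds hz)
  exact this.mdifferentiableAt (by simp)

theorem chartDeriv_chartSymmDeriv {x : X} {z : E} (hz : z ∈ (extChartAt I x).target) (u : E) :
    chartDeriv I x ((extChartAt I x).symm z) (chartSymmDeriv I x z u) = u := by
  have hy := (extChartAt I x).map_target hz
  have hc := (mdifferentiableAt_extChartAt_of_mem I hy).hasMFDerivAt.comp z
    (mdifferentiableAt_extChartAt_symm I hz).hasMFDerivAt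
  have hid : extChartAt I x ∘ (extChartAt I x).symm =ᶠ[𝓝 z] id :=
    Filter.eventually_of_mem ((isOpen_extChartAt_target x).mem_nhds hz) fun y hy =>
      (extChartAt I x).right_inv hy
  have heq := (hc.congr_of_eventuallyEq hid.symm).mfderiv
  rw [mfderiv_id] at heq
  exact (congrArg (fun L : E →L[ℝ] E => L u) heq).symm

theorem chartSymmDeriv_chartDeriv {x y : X} (hy : y ∈ (extChartAt I x).source) (u : E) :
    chartSymmDeriv I x (extChartAt I x y) (chartDeriv I x y u) = u := by
  have hz := (extChartAt I x).map_source hy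
  have hc := (mdifferentiableAt_extChartAt_symm I hz).hasMFDerivAt.comp y
    (mdifferentiableAt_extChartAt_of_mem I hy).hasMFDerivAt
  have hid : (extChartAt I x).symm ∘ extChartAt I x =ᶠ[𝓝 y] id :=
    Filter.eventually_of_mem ((isOpen_extChartAt_source x).mem_nhds hy) fun y hy =>
      (extChartAt I x).left_inv hy
  have heq := (hc.congr_of_eventuallyEq hid.symm).mfderiv
  rw [mfderiv_id] at heq
  exact (congrArg (fun L : E →L[ℝ] E => L u) heq).symm

theorem bijective_chartDeriv {x y : X} (hy : y ∈ (extChartAt I x).source) :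
    Function.Bijective (chartDeriv I x y) := by
  refine ⟨Function.LeftInverse.injective (chartSymmDeriv_chartDeriv I hy), fun u =>
    ⟨chartSymmDeriv I x (extChartAt I x y) u, ?_⟩⟩
  have := chartDeriv_chartSymmDeriv I ((extChartAt I x).map_source hy) u
  rwa [(extChartAt I x).left_inv hy] at this

theorem bijective_chartSymmDeriv {x : X} {z : E} (hz : z ∈ (extChartAt I x).target) :
    Function.Bijective (chartSymmDeriv I x z) := by
  refine ⟨Function.LeftInverse.injective (chartDeriv_chartSymmDeriv I hz), fun u =>
    ⟨chartDeriv I x ((extChartAt I x).symm z) u, ?_⟩⟩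
  have := chartSymmDeriv_chartDeriv I ((extChartAt I x).map_target hz) u
  rwa [(extChartAt I x).right_inv hz] at this

end Charts

/-! ### The projection and the connection form in charts -/

namespace PrincipalBundle

variable (B : PrincipalBundle IM IG IP M G P)

/-- The bundle projection in the charts at `p` and at its projection. -/
noncomputable def projInChart (p : P) : EP → EM :=
  fun z => extChartAt IM (B.proj p) (B.proj ((extChartAt IP p).symm z))

/-- The domain of the bundle projection in the charts at `p` and at its projection. -/
def chartDomain (p : P) : Set EP :=
  (extChartAt IP p).target ∩
    (extChartAt IP p).symm ⁻¹' (B.proj ⁻¹' (extChartAt IM (B.proj p)).source)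

theorem mem_chartDomain (p : P) : extChartAt IP p p ∈ B.chartDomain p :=
  ⟨mem_extChartAt_target p, by simp⟩

theorem isOpen_chartDomain [IP.Boundaryless] (p : P) : IsOpen (B.chartDomain p) :=
  (continuousOn_extChartAt_symm p).isOpen_inter_preimage (isOpen_extChartAt_target p)
    ((isOpen_extChartAt_source _).preimage B.contMDiff_proj.continuous)

variable [IsManifold IM ∞ M] [IsManifold IP ∞ P]

theorem contDiffOn_projInChart (p : P) : ContDiffOn ℝ ∞ (B.projInChart p) (B.chartDomain p) := by
  rw [← contMDiffOn_iff_contDiffOn]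
  exact (contMDiffOn_extChartAt.comp ((B.contMDiff_proj.contMDiffOn (s := univ)).comp
    ((contMDiffOn_extChartAt_symm p).mono inter_subset_left) fun _ _ => trivial) fun z hz => by
      rw [← extChartAt_source (I := IM)]; exact hz.2)

theorem fderiv_projInChart [IM.Boundaryless] [IP.Boundaryless] {p : P} {z : EP}
    (hz : z ∈ B.chartDomain p) :
    fderiv ℝ (B.projInChart p) z =
      (chartDeriv IM (B.proj p) (B.proj ((extChartAt IP p).symm z))).comp
        ((B.projDeriv ((extChartAt IP p).symm z)).comp (chartSymmDeriv IP p z)) := by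
  have h1 := (mdifferentiableAt_extChartAt_symm IP hz.1).hasMFDerivAt
  have h2 : MDifferentiableAt IP IM B.proj ((extChartAt IP p).symm z) :=
    B.contMDiff_proj.mdifferentiableAt (by simp)
  have h3 := (mdifferentiableAt_extChartAt_of_mem IM (x := B.proj p) hz.2).hasMFDerivAt
  rw [← mfderiv_eq_fderiv]
  exact (h3.comp z (h2.hasMFDerivAt.comp z h1)).mfderiv

end PrincipalBundle

namespace PrincipalConnection

variable {B : PrincipalBundle IM IG IP M G P} (A : PrincipalConnection B)

/-- The connection form in the chart at `p`. -/
noncomputable def localForm (p : P) : EP → EP →L[ℝ] EG :=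
  fun z => (A.formAt ((extChartAt IP p).symm z)).comp (chartSymmDeriv IP p z)

variable [IP.Boundaryless] [IsManifold IP ∞ P]

variable {A} in
-- On horizontal vectors the bracket term of the curvature vanishes, so flatness reduces to `dω = 0`
-- there. This is the hypothesis `hflat` of `exists_horizontalLift`.
theorem IsFlat.fderiv_localForm (hA : A.IsFlat) {p : P} {z : EP}
    (hz : z ∈ (extChartAt IP p).target) {u v : EP} (hu : A.localForm p z u = 0)
    (hv : A.localForm p z v = 0) :
    fderiv ℝ (A.localForm p) z u v = fderiv ℝ (A.localForm p) z v u := by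
  let q := (extChartAt IP p).symm z
  have h := hA p q ((extChartAt IP p).map_target hz) (chartSymmDeriv IP p z u)
    (chartSymmDeriv IP p z v)
  have hu' : A.form q (chartSymmDeriv IP p z u) = 0 := hu
  have hv' : A.form q (chartSymmDeriv IP p z v) = 0 := hv
  unfold curvature at h
  rw [hu', hv', GroupLieAlgebra.zero_bracket_zero] at h
  have h' : fderiv ℝ (A.localForm p) (extChartAt IP p q)
        (chartDeriv IP p q (chartSymmDeriv IP p z u)) (chartDeriv IP p q (chartSymmDeriv IP p z v)) -
      fderiv ℝ (A.localForm p) (extChartAt IP p q)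
        (chartDeriv IP p q (chartSymmDeriv IP p z v)) (chartDeriv IP p q (chartSymmDeriv IP p z u)) =
      0 := (add_zero _).symm.trans h
  rw [chartDeriv_chartSymmDeriv IP hz, chartDeriv_chartSymmDeriv IP hz,
    (extChartAt IP p).right_inv hz] at h'
  exact sub_eq_zero.1 h'

variable [IM.Boundaryless] [IsManifold IM ∞ M]

theorem bijective_fderiv_projInChart_prod_localForm [FiniteDimensional ℝ EM]
    [FiniteDimensional ℝ EG] [FiniteDimensional ℝ EP] [IsManifold IG ∞ G] {p : P} {z : EP}
    (hz : z ∈ B.chartDomain p) :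
    Function.Bijective ((fderiv ℝ (B.projInChart p) z).prod (A.localForm p z)) := by
  have h := (Function.Bijective.prodMap (bijective_chartDeriv IM (x := B.proj p) hz.2)
    (Function.bijective_id (α := EG))).comp
    ((A.bijective_mfderiv_proj_prod_form ((extChartAt IP p).symm z)).comp
      (bijective_chartSymmDeriv IP hz.1))
  rw [B.fderiv_projInChart hz]
  exact h

variable {A} in
/-- Horizontal lifts in the chart at `p`. -/
theorem IsFlat.exists_lift [FiniteDimensional ℝ EM]
    [FiniteDimensional ℝ EG] [FiniteDimensional ℝ EP] [IsManifold IG ∞ G] (hA : A.IsFlat) (p : P) :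
    ∃ F : EP → EM →L[ℝ] EP, ∀ z ∈ B.chartDomain p, ContDiffAt ℝ ∞ F z ∧
      (∀ v, fderiv ℝ (B.projInChart p) z (F z v) = v) ∧ (∀ v, A.localForm p z (F z v) = 0) ∧
      (∀ w, A.localForm p z w = 0 → F z (fderiv ℝ (B.projInChart p) z w) = w) ∧
      ∀ h k, fderiv ℝ F z (F z h) k = fderiv ℝ F z (F z k) h :=
  exists_horizontalLift (B.isOpen_chartDomain p) (B.contDiffOn_projInChart p)
    ((show ContDiffOn ℝ ∞ (A.localForm p) (extChartAt IP p).target from A.smooth p).mono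
      inter_subset_left)
    (fun _ hz => A.bijective_fderiv_projInChart_prod_localForm hz)
    (fun _ hz _ _ hu hv => hA.fderiv_localForm hz.1 hu hv)

end PrincipalConnection

/-! ### Uniqueness for linear differential inequalities -/

open Filter in
-- The derivative is controlled only on the open interval, so Grönwall is applied from an interior
-- point `s`, and then `s` tends to `a`.
theorem eq_zero_right_of_norm_deriv_le {E : Type*} [NormedAddCommGroup E] [NormedSpace ℝ E]
    {u u' : ℝ → E} {a b K : ℝ} (hab : a < b) (hu : ContinuousOn u (Icc a b))
    (hd : ∀ t ∈ Ioo a b, HasDerivAt u (u' t) t) (hK : ∀ t ∈ Ioo a b, ‖u' t‖ ≤ K * ‖u t‖)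
    (ha : u a = 0) : u b = 0 := by
  have hle : ∀ s ∈ Ioo a b, ‖u b‖ ≤ ‖u s‖ * Real.exp (K * (b - s)) := fun s hs => by
    have := norm_le_gronwallBound_of_norm_deriv_right_le (f := u) (f' := u') (δ := ‖u s‖) (K := K)
      (ε := 0) (a := s) (b := b) (hu.mono (Icc_subset_Icc_left hs.1.le))
      (fun x hx => (hd x ⟨hs.1.trans_le hx.1, hx.2⟩).hasDerivWithinAt) le_rfl
      (fun x hx => by rw [add_zero]; exact hK x ⟨hs.1.trans_le hx.1, hx.2⟩) b ⟨hs.2.le, le_rfl⟩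
    rwa [gronwallBound_ε0] at this
  have hlim : Tendsto (fun s => ‖u s‖ * Real.exp (K * (b - s))) (𝓝[Ioo a b] a)
      (𝓝 (‖u a‖ * Real.exp (K * (b - a)))) :=
    (((hu a (left_mem_Icc.2 hab.le)).mono Ioo_subset_Icc_self).norm).mul
      ((by fun_prop : Continuous fun s => Real.exp (K * (b - s))).continuousWithinAt)
  have : (𝓝[Ioo a b] a).NeBot := left_nhdsWithin_Ioo_neBot hab
  have h := ge_of_tendsto hlim (eventually_nhdsWithin_of_forall hle)
  rw [ha, norm_zero, zero_mul] at h
  exact norm_le_zero_iff.1 h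

theorem eq_zero_left_of_norm_deriv_le {E : Type*} [NormedAddCommGroup E] [NormedSpace ℝ E]
    {u u' : ℝ → E} {a b K : ℝ} (hab : a < b) (hu : ContinuousOn u (Icc a b))
    (hd : ∀ t ∈ Ioo a b, HasDerivAt u (u' t) t) (hK : ∀ t ∈ Ioo a b, ‖u' t‖ ≤ K * ‖u t‖)
    (hb : u b = 0) : u a = 0 := by
  have := eq_zero_right_of_norm_deriv_le (u := fun t => u (-t)) (u' := fun t => -u' (-t)) (K := K)
    (neg_lt_neg hab)
    (hu.comp (by fun_prop) fun t ht => ⟨by linarith [ht.2], by linarith [ht.1]⟩)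
    (fun t ht => by
      have ht' : -t ∈ Ioo a b := ⟨by linarith [ht.2], by linarith [ht.1]⟩
      have := (hd (-t) ht').scomp t (hasDerivAt_neg t)
      rw [neg_one_smul] at this
      exact this)
    (fun t ht => by
      rw [norm_neg]; exact hK (-t) ⟨by linarith [ht.2], by linarith [ht.1]⟩) (by simpa using hb)
  simpa using this

/-! ### Horizontal local sections of a flat connection -/

namespace PrincipalConnection

variable {B : PrincipalBundle IM IG IP M G P} (A : PrincipalConnection B)

/-- A `C¹` local section of the bundle on the open set `U` that is tangent to the horizontal
distribution. -/
structure IsHorizontalSection (U : Set M) (σ : M → P) : Prop where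
  isOpen : IsOpen U
  contMDiffOn : ContMDiffOn IM IP 1 σ U
  proj_apply : ∀ y ∈ U, B.proj (σ y) = y
  horizontal : ∀ y ∈ U, ∀ v : TangentSpace IM y, A.form (σ y) (mfderiv IM IP σ y v) = 0

/-- The curve `γ` is `C¹` on `[a, b]` and horizontal on the interior. -/
def IsHorizontalOn (γ : ℝ → P) (a b : ℝ) : Prop :=
  ContMDiffOn 𝓘(ℝ, ℝ) IP 1 γ (Icc a b) ∧ ∀ t ∈ Ioo a b, A.IsHorizontalAt γ t

variable {A}

theorem IsHorizontalOn.mdifferentiableAt {γ : ℝ → P} {a b t : ℝ} (h : A.IsHorizontalOn γ a b)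
    (ht : t ∈ Ioo a b) : MDifferentiableAt 𝓘(ℝ, ℝ) IP γ t :=
  (h.1.contMDiffAt (Icc_mem_nhds ht.1 ht.2)).mdifferentiableAt (by simp)

theorem IsHorizontalOn.act {γ : ℝ → P} {a b : ℝ} (h : A.IsHorizontalOn γ a b) (g : G) :
    A.IsHorizontalOn (fun t => B.act (γ t) g) a b :=
  ⟨((B.contMDiff_act_right g).of_le (by simp)).comp_contMDiffOn h.1,
    fun t ht => (h.2 t ht).act g (h.mdifferentiableAt ht)⟩

theorem IsHorizontalSection.isHorizontalOn {U : Set M} {σ : M → P}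
    (hσ : A.IsHorizontalSection U σ) {c : ℝ → M} {a b : ℝ}
    (hc : ContMDiffOn 𝓘(ℝ, ℝ) IM 1 c (Icc a b)) (hcU : ∀ t ∈ Icc a b, c t ∈ U) :
    A.IsHorizontalOn (fun t => σ (c t)) a b := by
  refine ⟨hσ.contMDiffOn.comp hc hcU, fun t ht => ?_⟩
  have htU := hcU t (Ioo_subset_Icc_self ht)
  have h1 : MDifferentiableAt 𝓘(ℝ, ℝ) IM c t :=
    (hc.contMDiffAt (Icc_mem_nhds ht.1 ht.2)).mdifferentiableAt (by simp)
  have h2 : MDifferentiableAt IM IP σ (c t) :=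
    (hσ.contMDiffOn.contMDiffAt (hσ.isOpen.mem_nhds htU)).mdifferentiableAt (by simp)
  have h3 := (h2.hasMFDerivAt.comp t h1.hasMFDerivAt).mfderiv
  unfold IsHorizontalAt
  change A.form (σ (c t)) (mfderiv 𝓘(ℝ, ℝ) IP (σ ∘ c) t (1 : ℝ)) = 0
  rw [h3]
  exact hσ.horizontal (c t) htU _

variable [IP.Boundaryless] [IsManifold IP ∞ P] [IM.Boundaryless] [IsManifold IM ∞ M]
  [FiniteDimensional ℝ EM] [FiniteDimensional ℝ EG] [FiniteDimensional ℝ EP] [IsManifold IG ∞ G]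

/-- A flat connection has horizontal local sections. -/
theorem IsFlat.exists_isHorizontalSection (hA : A.IsFlat) (p : P) :
    ∃ U σ, A.IsHorizontalSection U σ ∧ B.proj p ∈ U ∧ σ (B.proj p) = p := by
  have := FiniteDimensional.complete ℝ EP
  obtain ⟨F, hF⟩ := hA.exists_lift p
  have hO := (B.isOpen_chartDomain p).mem_nhds (B.mem_chartDomain p)
  obtain ⟨r, hr, s, hs0, hs⟩ := exists_hasFDerivAt_of_integrable (F := F)
    (extChartAt IM (B.proj p) (B.proj p))
    (((hF _ (B.mem_chartDomain p)).1).of_le (WithTop.coe_le_coe.2 le_top))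
    (Filter.eventually_of_mem hO fun z hz => (hF z hz).2.2.2.2) hO
  set x₀ := extChartAt IM (B.proj p) (B.proj p)
  have hsd : DifferentiableOn ℝ s (Metric.ball x₀ r) := fun x hx =>
    (hs x hx).2.differentiableAt.differentiableWithinAt
  have hs1 : ContDiffOn ℝ 1 s (Metric.ball x₀ r) := by
    rw [show (1 : WithTop ℕ∞) = 0 + 1 from rfl,
      contDiffOn_succ_iff_fderiv_of_isOpen Metric.isOpen_ball, contDiffOn_zero]
    refine ⟨hsd, by simp, ContinuousOn.congr (f := fun x => F (s x)) (fun x hx => ?_)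
      fun x hx => (hs x hx).2.fderiv⟩
    exact (hF _ (hs x hx).1).1.continuousAt.comp_continuousWithinAt (hsd.continuousOn x hx)
  -- The Frobenius solution is a section: its composite with the projection has the identity as
  -- derivative and fixes `x₀`, and the ball is connected.
  have hfs : ∀ x ∈ Metric.ball x₀ r, B.projInChart p (s x) = x := fun x hx => by
    have hder : ∀ y ∈ Metric.ball x₀ r,
        HasFDerivAt (fun y => B.projInChart p (s y)) (ContinuousLinearMap.id ℝ EM) y :=
      fun y hy => by
        have hd := ((B.contDiffOn_projInChart p).contDiffAt ((B.isOpen_chartDomain p).mem_nhds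
          (hs y hy).1)).differentiableAt (by simp)
        have := hd.hasFDerivAt.comp y (hs y hy).2
        convert! this using 1
        ext v
        exact ((hF _ (hs y hy).1).2.1 v).symm
    refine Metric.isOpen_ball.eqOn_of_fderiv_eq (𝕜 := ℝ) (f := fun y => B.projInChart p (s y))
      (g := fun y => y) (convex_ball x₀ r).isPreconnected
      (fun y hy => (hder y hy).differentiableAt.differentiableWithinAt)
      differentiableOn_id (fun y hy => ?_) (Metric.mem_ball_self hr) ?_ hx
    · exact (hder y hy).fderiv.trans fderiv_fun_id.symm
    · simp only [hs0, PrincipalBundle.projInChart, extChartAt_to_inv]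
      rfl
  let ψ := extChartAt IM (B.proj p)
  let U : Set M := ψ.source ∩ ψ ⁻¹' Metric.ball x₀ r
  have hUo : IsOpen U :=
    (continuousOn_extChartAt _).isOpen_inter_preimage (isOpen_extChartAt_source _)
      Metric.isOpen_ball
  have hs1' : ContMDiffOn 𝓘(ℝ, EM) 𝓘(ℝ, EP) 1 s (Metric.ball x₀ r) := hs1.contMDiffOn
  have hψ : ContMDiffOn IM 𝓘(ℝ, EM) 1 ψ U :=
    ((contMDiffOn_extChartAt (I := IM) (n := ∞) (x := B.proj p)).of_le (by simp)).mono fun y hy => by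
      rw [← extChartAt_source (I := IM)]; exact hy.1
  have hφ : ContMDiffOn 𝓘(ℝ, EP) IP 1 (extChartAt IP p).symm (extChartAt IP p).target :=
    (contMDiffOn_extChartAt_symm (I := IP) (n := ∞) p).of_le (by simp)
  refine ⟨U, fun y => (extChartAt IP p).symm (s (ψ y)), ⟨hUo, ?_, fun y hy => ?_,
    fun y hy v => ?_⟩, ⟨mem_extChartAt_source _, Metric.mem_ball_self hr⟩, ?_⟩
  · exact hφ.comp (hs1'.comp hψ fun y hy => hy.2) fun y hy => (hs _ hy.2).1.1
  · exact ψ.injOn (hs _ hy.2).1.2 hy.1 (hfs _ hy.2)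
  · have h1 : MDifferentiableAt IM 𝓘(ℝ, EM) ψ y := mdifferentiableAt_extChartAt_of_mem IM hy.1
    have h2 : MDifferentiableAt 𝓘(ℝ, EM) 𝓘(ℝ, EP) s (ψ y) :=
      (hs _ hy.2).2.differentiableAt.mdifferentiableAt
    have h3 := mdifferentiableAt_extChartAt_symm IP (hs _ hy.2).1.1
    have h4 := (h3.hasMFDerivAt.comp y (h2.hasMFDerivAt.comp y h1.hasMFDerivAt)).mfderiv
    have h5 : mfderiv 𝓘(ℝ, EM) 𝓘(ℝ, EP) s (ψ y) = F (s (ψ y)) := by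
      rw [mfderiv_eq_fderiv]; exact (hs _ hy.2).2.fderiv
    rw [h5] at h4
    change A.form _ (mfderiv IM IP ((extChartAt IP p).symm ∘ s ∘ ψ) y v) = 0
    rw [h4]
    exact (hF _ (hs _ hy.2).1).2.2.1 (chartDeriv IM (B.proj p) y v)
  · change (extChartAt IP p).symm (s x₀) = p
    rw [hs0, extChartAt_to_inv]

end PrincipalConnection

/-! ### Local uniqueness of horizontal lifts -/

namespace PrincipalConnection

variable {B : PrincipalBundle IM IG IP M G P} {A : PrincipalConnection B}
  [IP.Boundaryless] [IsManifold IP ∞ P] [IsManifold IM ∞ M]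

/-- In a chart, the velocity of a horizontal curve is the horizontal lift of the velocity of its
projection. -/
theorem IsHorizontalOn.hasDerivAt_chart {p : P} {F : EP → EM →L[ℝ] EP}
    (hF : ∀ z ∈ B.chartDomain p, ∀ w, A.localForm p z w = 0 →
      F z (fderiv ℝ (B.projInChart p) z w) = w)
    {γ : ℝ → P} {a b t : ℝ} (hγ : A.IsHorizontalOn γ a b) (ht : t ∈ Ioo a b)
    (hp : γ t ∈ (extChartAt IP p).source) (hz : extChartAt IP p (γ t) ∈ B.chartDomain p) :
    HasDerivAt (fun t => extChartAt IP p (γ t)) (F (extChartAt IP p (γ t))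
      (deriv (fun t => extChartAt IM (B.proj p) (B.proj (γ t))) t)) t := by
  have hd := hγ.mdifferentiableAt ht
  let w : EP := mfderiv 𝓘(ℝ, ℝ) IP γ t (1 : ℝ)
  let u : EP := chartDeriv IP p (γ t) w
  have h1 : HasDerivAt (fun t => extChartAt IP p (γ t)) u t := by
    have hc := ((mdifferentiableAt_extChartAt_of_mem IP hp).hasMFDerivAt.comp t
      hd.hasMFDerivAt)
    have hd' := hc.mdifferentiableAt.differentiableAt.hasDerivAt
    rw [← fderiv_apply_one_eq_deriv, ← mfderiv_eq_fderiv, hc.mfderiv] at hd'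
    exact hd'
  have hh : A.localForm p (extChartAt IP p (γ t)) u = 0 := by
    have : A.formAt (γ t) w = 0 := hγ.2 t ht
    simp only [localForm, u, ContinuousLinearMap.comp_apply, chartSymmDeriv_chartDeriv IP hp,
      (extChartAt IP p).left_inv hp, this]
  have h2 : HasDerivAt (fun t => extChartAt IM (B.proj p) (B.proj (γ t)))
      (fderiv ℝ (B.projInChart p) (extChartAt IP p (γ t)) u) t := by
    have hf := (((B.contDiffOn_projInChart p).contDiffAt ((B.isOpen_chartDomain p).mem_nhds
      hz)).differentiableAt (by simp)).hasFDerivAt.comp_hasDerivAt t h1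
    refine hf.congr_of_eventuallyEq ?_
    filter_upwards [hd.continuousAt.preimage_mem_nhds
      ((isOpen_extChartAt_source (I := IP) p).mem_nhds hp)] with r hr
    simp only [Function.comp_apply, PrincipalBundle.projInChart, (extChartAt IP p).left_inv hr]
  rw [h2.deriv, hF _ hz u hh]
  exact h1

variable [IM.Boundaryless] [FiniteDimensional ℝ EM] [FiniteDimensional ℝ EG]
  [FiniteDimensional ℝ EP] [IsManifold IG ∞ G]

/-- Horizontal curves with the same projection that stay in a small neighbourhood of a point and
agree at one end point agree at the other. -/
theorem IsFlat.exists_nhds_unique_lift (hA : A.IsFlat) (p : P) :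
    ∃ N ∈ 𝓝 p, ∀ (γ δ : ℝ → P) (a b : ℝ), a < b → A.IsHorizontalOn γ a b →
      A.IsHorizontalOn δ a b → (∀ t ∈ Icc a b, γ t ∈ N ∧ δ t ∈ N ∧ B.proj (γ t) = B.proj (δ t)) →
      (γ a = δ a ↔ γ b = δ b) := by
  obtain ⟨F, hF⟩ := hA.exists_lift p
  have hO := (B.isOpen_chartDomain p).mem_nhds (B.mem_chartDomain p)
  obtain ⟨K, S, hS, hK⟩ := ((hF _ (B.mem_chartDomain p)).1.of_le
    (by simp : (1 : WithTop ℕ∞) ≤ ∞)).exists_lipschitzOnWith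
  refine ⟨(extChartAt IP p).source ∩ extChartAt IP p ⁻¹' (B.chartDomain p ∩ S),
    Filter.inter_mem (extChartAt_source_mem_nhds p)
      ((continuousAt_extChartAt p).preimage_mem_nhds (Filter.inter_mem hO hS)), ?_⟩
  intro γ δ a b hab hγ hδ hN
  have hproj : ∀ t ∈ Icc a b, B.proj (γ t) ∈ (extChartAt IM (B.proj p)).source := fun t ht => by
    have h := (hN t ht).1
    have h' := h.2.1.2
    simp only [mem_preimage, (extChartAt IP p).left_inv h.1] at h'
    exact h'
  let c : ℝ → EM := fun t => extChartAt IM (B.proj p) (B.proj (γ t))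
  have hc : ContDiffOn ℝ 1 c (Icc a b) := by
    rw [← contMDiffOn_iff_contDiffOn]
    exact ((contMDiffOn_extChartAt (I := IM) (n := ∞) (x := B.proj p)).of_le (by simp)).comp
      ((B.contMDiff_proj.of_le (by simp)).comp_contMDiffOn hγ.1) fun t ht => by
        rw [← extChartAt_source (I := IM)]; exact hproj t ht
  -- In the chart both curves solve `z' = F(z)c'`, with `c` their common projection. Since `F` is
  -- Lipschitz on `S` and `c'` is bounded, their difference satisfies a linear differential
  -- inequality.
  obtain ⟨C, hC⟩ : ∃ C, ∀ t ∈ Icc a b, ‖derivWithin c (Icc a b) t‖ ≤ C :=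
    isCompact_Icc.exists_bound_of_continuousOn
      (((contDiffOn_one_iff_derivWithin (uniqueDiffOn_Icc hab)).1 hc).2)
  have hcurve : ∀ η : ℝ → P, A.IsHorizontalOn η a b →
      (∀ t ∈ Icc a b, η t ∈ (extChartAt IP p).source ∩ extChartAt IP p ⁻¹' (B.chartDomain p ∩ S) ∧
        B.proj (η t) = B.proj (γ t)) →
      ContinuousOn (fun t => extChartAt IP p (η t)) (Icc a b) ∧
      ∀ t ∈ Ioo a b, HasDerivAt (fun t => extChartAt IP p (η t))
        (F (extChartAt IP p (η t)) (deriv c t)) t := by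
    intro η hη hηN
    refine ⟨(continuousOn_extChartAt p).comp hη.1.continuousOn fun t ht => (hηN t ht).1.1,
      fun t ht => ?_⟩
    have ht' := Ioo_subset_Icc_self ht
    have h := hη.hasDerivAt_chart (fun z hz => (hF z hz).2.2.2.1) ht (hηN t ht').1.1
      (hηN t ht').1.2.1
    have hcc : (fun t => extChartAt IM (B.proj p) (B.proj (η t))) =ᶠ[𝓝 t] c :=
      Filter.eventually_of_mem (Icc_mem_nhds ht.1 ht.2) fun r hr => by
        simp only [c, (hηN r hr).2]
    rwa [hcc.deriv_eq] at h
  have hγ' := hcurve γ hγ fun t ht => ⟨(hN t ht).1, rfl⟩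
  have hδ' := hcurve δ hδ fun t ht => ⟨(hN t ht).2.1, (hN t ht).2.2.symm⟩
  let u : ℝ → EP := fun t => extChartAt IP p (γ t) - extChartAt IP p (δ t)
  have hu : ContinuousOn u (Icc a b) := hγ'.1.sub hδ'.1
  have hud := fun t ht => (hγ'.2 t ht).sub (hδ'.2 t ht)
  have hbound : ∀ t ∈ Ioo a b, ‖F (extChartAt IP p (γ t)) (deriv c t) -
      F (extChartAt IP p (δ t)) (deriv c t)‖ ≤ (K * C) * ‖u t‖ := fun t ht => by
    have ht' := Ioo_subset_Icc_self ht
    have h1 := hK.dist_le_mul _ (hN t ht').1.2.2 _ (hN t ht').2.1.2.2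
    rw [dist_eq_norm, dist_eq_norm] at h1
    have h2 := hC t ht'
    rw [derivWithin_of_mem_nhds (Icc_mem_nhds ht.1 ht.2)] at h2
    rw [← sub_apply]
    refine (ContinuousLinearMap.le_opNorm _ _).trans
      ((mul_le_mul h1 h2 (norm_nonneg _) (by positivity)).trans (le_of_eq ?_))
    simp only [u]; ring
  have hiff : ∀ t ∈ Icc a b, γ t = δ t ↔ u t = 0 := fun t ht => by
    rw [sub_eq_zero]
    exact ((extChartAt IP p).injOn.eq_iff (hN t ht).1.1 (hN t ht).2.1.1).symm
  rw [hiff a (left_mem_Icc.2 hab.le), hiff b (right_mem_Icc.2 hab.le)]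
  exact ⟨eq_zero_right_of_norm_deriv_le hab hu hud hbound,
    eq_zero_left_of_norm_deriv_le hab hu hud hbound⟩

end PrincipalConnection

/-! ### Horizontal curves and sections are locally unique up to a constant group element -/

namespace PrincipalBundle

variable (B : PrincipalBundle IM IG IP M G P)

theorem surjective_proj : Function.Surjective B.proj := fun x => by
  obtain ⟨e, he, -⟩ := B.exists_trivialization x
  exact ⟨_, e.proj_symm_apply (x := (x, 1)) (e.mem_target.2 he)⟩

open Classical in
/-- The element of the structure group that takes `p` to `q`, if the two lie in the same fibre. -/
noncomputable def translation (p q : P) : G := if h : ∃ g, B.act p g = q then h.choose else 1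

theorem act_translation {p q : P} (h : B.proj p = B.proj q) : B.act p (B.translation p q) = q := by
  have h' := B.exists_act_eq h
  rw [translation, dif_pos h']
  exact h'.choose_spec

theorem translation_eq {p q : P} {g : G} (h : B.act p g = q) : B.translation p q = g :=
  B.act_right_injective p ((B.act_translation (by rw [← h, B.proj_act])).trans h.symm)

end PrincipalBundle

namespace PrincipalConnection

variable {B : PrincipalBundle IM IG IP M G P} {A : PrincipalConnection B}

theorem IsHorizontalSection.eventually_act_mem {U : Set M} {σ : M → P}
    (hσ : A.IsHorizontalSection U σ) {g : G} {y : M} (hy : y ∈ U) {p : P}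
    (hp : p = B.act (σ y) g) {N : Set P} (hN : N ∈ 𝓝 p) :
    ∀ᶠ z in 𝓝 y, z ∈ U ∧ B.act (σ z) g ∈ N := by
  have hU := hσ.isOpen.mem_nhds hy
  have hc : ContinuousAt (fun z => B.act (σ z) g) y :=
    (B.contMDiff_act_right g).continuous.continuousAt.comp
      (hσ.contMDiffOn.continuousOn.continuousAt hU)
  exact (Filter.eventually_of_mem hU fun _ h => h).and (hc.preimage_mem_nhds (hp ▸ hN))

variable [IP.Boundaryless] [IsManifold IP ∞ P] [IM.Boundaryless] [IsManifold IM ∞ M]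
  [FiniteDimensional ℝ EM] [FiniteDimensional ℝ EG] [FiniteDimensional ℝ EP] [IsManifold IG ∞ G]

/-- Horizontal curves are locally right translates of horizontal sections. -/
theorem IsFlat.eventually_eq_act (hA : A.IsFlat) {γ : ℝ → P} (hγc : Continuous γ) {s : Set ℝ}
    (hγ : IsPiecewiseC1With IP γ s) (hh : ∀ t ∈ Ioo (0 : ℝ) 1, t ∉ s → A.IsHorizontalAt γ t)
    {U : Set M} {σ : M → P} (hσ : A.IsHorizontalSection U σ) {t₀ : ℝ} (ht₀ : t₀ ∈ Icc (0 : ℝ) 1)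
    (hU : B.proj (γ t₀) ∈ U) {g : G} (hg : γ t₀ = B.act (σ (B.proj (γ t₀))) g) :
    ∀ᶠ t in 𝓝[Icc 0 1] t₀, B.proj (γ t) ∈ U ∧ γ t = B.act (σ (B.proj (γ t))) g := by
  obtain ⟨N, hN, huniq⟩ := hA.exists_nhds_unique_lift (γ t₀)
  have h1 : ∀ᶠ t in 𝓝 t₀, B.proj (γ t) ∈ U ∧ B.act (σ (B.proj (γ t))) g ∈ N :=
    (B.contMDiff_proj.continuous.comp hγc).continuousAt.eventually
      (hσ.eventually_act_mem hU hg hN)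
  -- The point `t₀` may itself be a break point; hence uniqueness is applied only to intervals that
  -- do not contain it in their interior, one on each side.
  have h2 : ∀ᶠ t in 𝓝 t₀, t ∉ s \ {t₀} :=
    (hγ.1.subset sdiff_subset).isClosed.isOpen_compl.mem_nhds fun h => h.2 rfl
  obtain ⟨ε, hε, hball⟩ := Metric.eventually_nhds_iff_ball.1
    ((h1.and h2).and (hγc.continuousAt.preimage_mem_nhds hN))
  rw [Real.ball_eq_Ioo] at hball
  have hiff : ∀ a b, a < b → Icc a b ⊆ Icc 0 1 → Icc a b ⊆ Ioo (t₀ - ε) (t₀ + ε) →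
      t₀ ∉ Ioo a b → (γ a = B.act (σ (B.proj (γ a))) g ↔ γ b = B.act (σ (B.proj (γ b))) g) := by
    intro a b hab hab1 habε htab
    have ha := left_mem_Icc.2 hab.le
    have hb := right_mem_Icc.2 hab.le
    have hs : ∀ t ∈ Ioo a b, t ∉ s := fun t ht hts =>
      (hball t (habε (Ioo_subset_Icc_self ht))).1.2 ⟨hts, fun h => htab (h ▸ ht)⟩
    have hγab : A.IsHorizontalOn γ a b :=
      ⟨hγ.2 a b (hab1 ha).1 hab (hab1 hb).2 (Set.disjoint_left.2 hs), fun t ht =>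
        hh t ⟨(hab1 ha).1.trans_lt ht.1, ht.2.trans_le (hab1 hb).2⟩ (hs t ht)⟩
    have hδ := (hσ.isHorizontalOn ((B.contMDiff_proj.of_le (by simp)).comp_contMDiffOn hγab.1)
      fun t ht => (hball t (habε ht)).1.1.1).act g
    exact huniq γ _ a b hab hγab hδ fun t ht => ⟨(hball t (habε ht)).2, (hball t (habε ht)).1.1.2,
      ((B.proj_act _ _).trans (hσ.proj_apply _ (hball t (habε ht)).1.1.1)).symm⟩
  rw [eventually_nhdsWithin_iff]
  filter_upwards [Ioo_mem_nhds (show t₀ - ε < t₀ by linarith) (show t₀ < t₀ + ε by linarith)]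
    with t ht ht1
  refine ⟨(hball t ht).1.1.1, ?_⟩
  rcases lt_trichotomy t t₀ with h | h | h
  · exact (hiff t t₀ h (Icc_subset_Icc ht1.1 ht₀.2)
      (fun r hr => ⟨ht.1.trans_le hr.1, by linarith [hr.2]⟩) fun h => lt_irrefl _ h.2).2 hg
  · rw [h]; exact hg
  · exact (hiff t₀ t h (Icc_subset_Icc ht₀.1 ht1.2)
      (fun r hr => ⟨by linarith [hr.1], hr.2.trans_lt ht.2⟩) fun h => lt_irrefl _ h.1).1 hg

/-- Two horizontal sections locally differ by a constant element of the structure group. -/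
theorem IsFlat.eventually_section_eq (hA : A.IsFlat) {U U' : Set M} {σ σ' : M → P}
    (hσ : A.IsHorizontalSection U σ) (hσ' : A.IsHorizontalSection U' σ') {y : M} (hy : y ∈ U)
    (hy' : y ∈ U') {g : G} (hg : σ' y = B.act (σ y) g) : ∀ᶠ z in 𝓝 y, σ' z = B.act (σ z) g := by
  obtain ⟨N, hN, huniq⟩ := hA.exists_nhds_unique_lift (σ' y)
  have h1 := (hσ.eventually_act_mem hy hg hN).and
    (hσ'.eventually_act_mem hy' (g := 1) (B.act_one _).symm hN)
  let ψ := extChartAt IM y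
  have h2 : ∀ᶠ x in 𝓝 (ψ y), ψ.symm x ∈ U ∩ U' ∧ B.act (σ (ψ.symm x)) g ∈ N ∧
      σ' (ψ.symm x) ∈ N ∧ x ∈ ψ.target := by
    have hcont := continuousAt_extChartAt_symm (I := IM) y
    have h3 := hcont.eventually (by rwa [extChartAt_to_inv])
    filter_upwards [h3, (isOpen_extChartAt_target y).mem_nhds (mem_extChartAt_target y)]
      with x hx hx'
    rw [B.act_one] at hx
    exact ⟨⟨hx.1.1, hx.2.1⟩, hx.1.2, hx.2.2, hx'⟩
  obtain ⟨ε, hε, hball⟩ := Metric.eventually_nhds_iff_ball.1 h2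
  filter_upwards [extChartAt_source_mem_nhds (I := IM) y,
    (continuousAt_extChartAt (I := IM) y).preimage_mem_nhds (Metric.ball_mem_nhds _ hε)] with z hz hzε
  -- A straight segment in the chart joins `y` to `z`. Both sections are horizontal along it, so
  -- agreement up to `g` at `y` carries over to `z`.
  let l : ℝ → EM := fun t => ψ y + t • (ψ z - ψ y)
  have hl : ∀ t ∈ Icc (0 : ℝ) 1, l t ∈ Metric.ball (ψ y) ε := fun t ht =>
    (convex_ball (ψ y) ε).add_smul_sub_mem (Metric.mem_ball_self hε) hzε ht
  have hl1 : ContMDiffOn 𝓘(ℝ, ℝ) 𝓘(ℝ, EM) 1 l (Icc 0 1) :=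
    (ContDiff.contMDiff (by fun_prop)).contMDiffOn
  have hc : ContMDiffOn 𝓘(ℝ, ℝ) IM 1 (fun t => ψ.symm (l t)) (Icc 0 1) :=
    ((contMDiffOn_extChartAt_symm (I := IM) (n := ∞) y).of_le (by simp)).comp hl1
      fun t ht => (hball _ (hl t ht)).2.2.2
  have hγ := hσ'.isHorizontalOn hc fun t ht => (hball _ (hl t ht)).1.2
  have hδ := (hσ.isHorizontalOn hc fun t ht => (hball _ (hl t ht)).1.1).act g
  have h := huniq _ _ 0 1 zero_lt_one hγ hδ fun t ht => ⟨(hball _ (hl t ht)).2.2.1,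
    (hball _ (hl t ht)).2.1, by
      rw [B.proj_act, hσ.proj_apply _ (hball _ (hl t ht)).1.1,
        hσ'.proj_apply _ (hball _ (hl t ht)).1.2]⟩
  have hl0 : ψ.symm (l 0) = y := by simp only [l, zero_smul, add_zero]; exact extChartAt_to_inv y
  have hl1 : ψ.symm (l 1) = z := by
    simp only [l, one_smul, add_sub_cancel]; exact ψ.left_inv hz
  simp only [hl0, hl1] at h
  exact h.1 hg

end PrincipalConnection

/-! ### The covering defined by a flat connection, and homotopy invariance of horizontal lifts -/

/-- A type with the discrete topology. -/
def DiscreteCopy (X : Type*) : Type _ := X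

instance (X : Type*) : TopologicalSpace (DiscreteCopy X) := ⊥

instance (X : Type*) : DiscreteTopology (DiscreteCopy X) := ⟨rfl⟩

namespace PrincipalConnection

variable {B : PrincipalBundle IM IG IP M G P} {A : PrincipalConnection B}

/-- A family of horizontal sections that covers the base. -/
structure HorizontalAtlas (A : PrincipalConnection B) where
  /-- the domains of the sections -/
  dom : M → Set M
  /-- the sections -/
  sec : M → M → P
  isHorizontalSection : ∀ x, A.IsHorizontalSection (dom x) (sec x)
  mem_dom : ∀ x, x ∈ dom x

theorem HorizontalAtlas.proj_sec (S : A.HorizontalAtlas) {x y : M} (hy : y ∈ S.dom x) :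
    B.proj (S.sec x y) = y :=
  (S.isHorizontalSection x).proj_apply y hy

variable [IP.Boundaryless] [IsManifold IP ∞ P] [IM.Boundaryless] [IsManifold IM ∞ M]
  [FiniteDimensional ℝ EM] [FiniteDimensional ℝ EG] [FiniteDimensional ℝ EP] [IsManifold IG ∞ G]

theorem IsFlat.nonempty_horizontalAtlas (hA : A.IsFlat) : Nonempty A.HorizontalAtlas := by
  have h : ∀ x, ∃ U σ, A.IsHorizontalSection U σ ∧ x ∈ U := fun x => by
    obtain ⟨p, rfl⟩ := B.surjective_proj x
    obtain ⟨U, σ, h, hU, -⟩ := hA.exists_isHorizontalSection p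
    exact ⟨U, σ, h, hU⟩
  choose U σ h hU using h
  exact ⟨⟨U, σ, h, hU⟩⟩

/-- The covering of the base defined by a flat connection, whose fibres are copies of the structure
group with the discrete topology. -/
noncomputable def HorizontalAtlas.bundleCore (S : A.HorizontalAtlas) (hA : A.IsFlat) :
    FiberBundleCore M M (DiscreteCopy G) :=
  { baseSet := S.dom
    isOpen_baseSet := fun x => (S.isHorizontalSection x).isOpen
    indexAt := id
    mem_baseSet_at := S.mem_dom
    -- The coordinate of a point over `y` in the section `i` is the `g` that takes `S.sec i y` to
    -- it, so changing sections multiplies `g` on the left.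
    coordChange := fun i j y (g : G) => B.translation (S.sec j y) (S.sec i y) * g
    coordChange_self := fun i y _ (g : G) => by
      rw [B.translation_eq (B.act_one (S.sec i y)), one_mul]
    continuousOn_coordChange := fun i j => by
      rintro ⟨y, (g : G)⟩ ⟨⟨hi, hj⟩, -⟩
      have h : S.sec i y = B.act (S.sec j y) (B.translation (S.sec j y) (S.sec i y)) :=
        (B.act_translation (by rw [S.proj_sec hi, S.proj_sec hj])).symm
      -- The left factor is locally constant in `y`; this is what continuity requires when the fibre
      -- is discrete.
      have hev := hA.eventually_section_eq (S.isHorizontalSection j) (S.isHorizontalSection i)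
        hj hi h
      have hg : ∀ᶠ g' : DiscreteCopy G in @nhds (DiscreteCopy G) _ g, g' = g := by
        rw [nhds_discrete]; exact rfl
      refine (continuousAt_const (Y := DiscreteCopy G)
        (y := (B.translation (S.sec j y) (S.sec i y) * g : G))).congr ?_
        |>.continuousWithinAt
      filter_upwards [(hev.prod_inl_nhds (Y := DiscreteCopy G) g).and (hg.prod_inr_nhds y)] with q hq
      rw [B.translation_eq hq.1.symm, hq.2]
    coordChange_comp := fun i j k y hy (g : G) => by
      rw [← mul_assoc]
      congr 1
      refine (B.translation_eq ?_).symm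
      rw [B.act_mul, B.act_translation (by rw [S.proj_sec hy.2, S.proj_sec hy.1.2]),
        B.act_translation (by rw [S.proj_sec hy.1.2, S.proj_sec hy.1.1])] }

/-- For a flat connection, horizontal paths with the same starting point and homotopic projections
have the same end point. -/
theorem IsFlat.eq_of_homotopic (hA : A.IsFlat) {p q q' : P} {γ : Path p q} {γ' : Path p q'}
    (hγ : A.IsHorizontal γ) (hγ' : A.IsHorizontal γ') {x : M} {c c' : Path (B.proj p) x}
    (hc : ∀ t, B.proj (γ t) = c t) (hc' : ∀ t, B.proj (γ' t) = c' t) (h : c.Homotopic c') :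
    q = q' := by
  obtain ⟨S⟩ := hA.nonempty_horizontalAtlas
  let Z := S.bundleCore hA
  have hcov : IsCoveringMap
      (Bundle.TotalSpace.proj : Bundle.TotalSpace (DiscreteCopy G) Z.Fiber → M) :=
    FiberBundle.isCoveringMap
  -- Each point is recorded by its coordinate in the section chosen at its own base point. `Φ` need
  -- not be continuous for the manifold topology of `P`; only its continuity along horizontal paths
  -- is used.
  let Φ : P → Bundle.TotalSpace (DiscreteCopy G) Z.Fiber := fun r =>
    ⟨B.proj r, B.translation (S.sec (B.proj r) (B.proj r)) r⟩
  have hsec : ∀ r, B.proj (S.sec (B.proj r) (B.proj r)) = B.proj r := fun r =>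
    S.proj_sec (S.mem_dom _)
  have hcont : ∀ {q : P} {γ : Path p q}, A.IsHorizontal γ → Continuous fun t => Φ (γ t) := by
    rintro q γ ⟨s, hs, hh⟩
    rw [continuous_iff_continuousAt]
    intro t₀
    rw [FiberBundle.continuousAt_totalSpace]
    refine ⟨(B.contMDiff_proj.continuous.comp γ.continuous).continuousAt, ?_⟩
    set x₀ := B.proj (γ t₀)
    set g := B.translation (S.sec x₀ x₀) (γ t₀)
    have hx₀ : B.proj (γ.extend t₀) = x₀ := by rw [γ.extend_extends']
    have hg : γ.extend t₀ = B.act (S.sec x₀ (B.proj (γ.extend t₀))) g := by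
      rw [hx₀, γ.extend_extends']
      exact (B.act_translation (hsec _)).symm
    have hev := hA.eventually_eq_act γ.continuous_extend hs hh (S.isHorizontalSection x₀) t₀.2
      (hx₀ ▸ S.mem_dom x₀) hg
    have hev := (eventually_nhds_subtype_iff _ t₀ _).2 hev
    refine (continuousAt_const (Y := DiscreteCopy G) (y := g)).congr ?_
    filter_upwards [hev] with t ht
    rw [γ.extend_extends'] at ht
    symm
    -- In the trivialization indexed by `x₀`, the fibre coordinate of `Φ (γ t)` is a coordinate
    -- change applied to the own coordinate of `γ t`. It stays equal to `g` near `t₀`, because `γ`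
    -- is there the translate by `g` of the section at `x₀`.
    change B.translation (S.sec x₀ (B.proj (γ t))) (S.sec (B.proj (γ t)) (B.proj (γ t))) *
      B.translation (S.sec (B.proj (γ t)) (B.proj (γ t))) (γ t) = g
    rw [← B.translation_eq ht.2.symm]
    refine (B.translation_eq ?_).symm
    rw [B.act_mul, B.act_translation ((S.proj_sec ht.1).trans (hsec _).symm),
      B.act_translation (hsec _)]
  have hlift := hcov.liftPath_apply_one_eq_of_homotopicRel h (Φ p) (by simp [Φ]) (by simp [Φ])
  have h1 := (hcov.eq_liftPath_iff (γ := (c : C(unitInterval, M))) (e := Φ p) (by simp [Φ])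
    (Γ := fun t => Φ (γ t))).2 ⟨hcont hγ, funext hc, by simp⟩
  have h2 := (hcov.eq_liftPath_iff (γ := (c' : C(unitInterval, M))) (e := Φ p) (by simp [Φ])
    (Γ := fun t => Φ (γ' t))).2 ⟨hcont hγ', funext hc', by simp⟩
  have h3 : Φ q = Φ q' := by
    have e1 := congrFun h1 1
    have e2 := congrFun h2 1
    rw [Path.target] at e1 e2
    exact e1.trans (hlift.trans e2.symm)
  have hq : B.proj q = B.proj q' := congrArg Bundle.TotalSpace.proj h3
  -- A point is recovered from its image, so `Φ` is injective.
  have h4 : ∀ r, B.act (S.sec (Φ r).1 (Φ r).1) (Φ r).2 = r := fun r => B.act_translation (hsec r)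
  rw [← h4 q, h3, h4 q']

/-- If the fundamental group of the base is Abelian, so are the holonomy groups of flat
connections. -/
theorem IsFlat.isMulCommutative_holonomyGroup (hA : A.IsFlat) (p₀ : P)
    [IsMulCommutative (FundamentalGroup M (B.proj p₀))] :
    IsMulCommutative (A.holonomyGroup p₀) := by
  refine ⟨⟨?_⟩⟩
  rintro ⟨a, c, hc, γ, hγ, hγc⟩ ⟨b, d, hd, δ, hδ, hδd⟩
  -- The lift of `c` is translated by `b` to start where `δ` ends, and that of `d` by `a` to start
  -- where `γ` ends.
  obtain ⟨ε, hε, hεγ⟩ := hγ.exists_act b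
  obtain ⟨η, hη, hηδ⟩ := hδ.exists_act a
  have hcomm : (d.trans c).Homotopic (c.trans d) := by
    rw [← Path.Homotopic.Quotient.eq]
    exact mul_comm' (FundamentalGroup.fromPath (.mk c)) (FundamentalGroup.fromPath (.mk d))
  refine Subtype.ext (B.act_right_injective p₀ ?_)
  change B.act p₀ (a * b) = B.act p₀ (b * a)
  rw [B.act_mul, B.act_mul]
  refine hA.eq_of_homotopic (hδ.trans hε) (hγ.trans hη) (c := d.trans c) (c' := c.trans d)
    (fun t => ?_) (fun t => ?_) hcomm
  · simp only [Path.trans_apply]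
    split_ifs
    · exact hδd _
    · rw [hεγ, B.proj_act, hγc]
  · simp only [Path.trans_apply]
    split_ifs
    · exact hγc _
    · rw [hηδ, B.proj_act, hδd]

end PrincipalConnection

end PrincipalBundles

theorem mainTheorem3
    {EM : Type*} [NormedAddCommGroup EM] [NormedSpace ℝ EM] [FiniteDimensional ℝ EM]
    {HM : Type*} [TopologicalSpace HM] (IM : ModelWithCorners ℝ EM HM) [IM.Boundaryless]
    {EG : Type*} [NormedAddCommGroup EG] [NormedSpace ℝ EG] [FiniteDimensional ℝ EG]
    {HG : Type*} [TopologicalSpace HG] (IG : ModelWithCorners ℝ EG HG) [IG.Boundaryless]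
    {EP : Type*} [NormedAddCommGroup EP] [NormedSpace ℝ EP] [FiniteDimensional ℝ EP]
    {HP : Type*} [TopologicalSpace HP] (IP : ModelWithCorners ℝ EP HP) [IP.Boundaryless]
    -- the base manifold
    {M : Type*} [TopologicalSpace M] [ChartedSpace HM M] [IsManifold IM ∞ M]
    [T2Space M] [PathConnectedSpace M]
    -- the gauge group
    {G : Type*} [TopologicalSpace G] [ChartedSpace HG G] [Group G] [LieGroup IG ∞ G]
    -- the total space
    {P : Type*} [TopologicalSpace P] [ChartedSpace HP P] [IsManifold IP ∞ P]
    (B : PrincipalBundle IM IG IP M G P) (A : PrincipalConnection B)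
    (hflat : A.IsFlat) (hA : A.IsGenuinelyNonAbelian) :
    ¬ IsMulCommutative G ∧ ∀ x : M, ¬ IsMulCommutative (FundamentalGroup M x) := by
  obtain ⟨p₀, hp₀⟩ := hA
  refine ⟨fun hG => hp₀ ⟨⟨fun a b => Subtype.ext (mul_comm' (a : G) (b : G))⟩⟩, fun x hx => hp₀ ?_⟩
  have : IsManifold IG ∞ G := LieGroup.toContMDiffMul.toIsManifold
  have : IsMulCommutative (FundamentalGroup M (B.proj p₀)) := by
    let e := FundamentalGroup.fundamentalGroupMulEquivOfPathConnected (B.proj p₀) x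
    exact ⟨⟨fun a b => e.injective (by rw [map_mul, map_mul, mul_comm'])⟩⟩
  exact hflat.isMulCommutative_holonomyGroup p₀
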